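/- Let $F$ be a free group of rank $n$ with a fixed free basis, and let $\mathcal{T}$ be its Cayley graph (a tree). Let $w_1,\dots,w_r$ be a finite list of words in the basis and its inverses, and let $\mathcal{L}$ be the associated line pattern, consisting of the lines $\{g w_i^k\}_{k\in\mathbb{Z}}$, $g\in F$, $1\le i\le r$ (a word that is trivial in $F$ contributes no line). Let $\mathcal{D}$ be the decomposition space, i.e. the quotient $q\colon\partial_\infty F\to\mathcal{D}$ of the boundary of $F$ by the equivalence relation that identifies the two end points of each line in $\mathcal{L}$. Let $\check{\mathrm{H}}{}^0(\mathcal{D},\mathbb{Z})=\varinjlim_{\mathcal{U}}\check{\mathrm{H}}{}^0(\mathcal{U},\mathbb{Z})$, the direct limit over all open covers $\mathcal{U}$ of $\mathcal{D}$ ordered by refinement, where $\check{\mathrm{H}}{}^0(\mathcal{U},\mathbb{Z})=\ker(d^0\colon \check{\mathrm{C}}{}^0(\mathcal{U},\mathbb{Z})\to\check{\mathrm{C}}{}^1(\mathcal{U},\mathbb{Z}))$ is the group of 0-cycles of the nerve of $\mathcal{U}$. For a nonempty finite subtree $\mathcal{X}$ of $\mathcal{T}$, let $a_1,\dots,a_m$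 be the vertices of $\mathcal{T}$ adjacent to $\mathcal{X}$, and let $S(a_i)\subset\partial_\infty F$ be the set of boundary points $\xi$ such that the geodesic from $\mathcal{X}$ to $\xi$ contains $a_i$. The Whitehead graph of $\mathcal{L}$ at $\mathcal{X}$ has vertices $a_1,\dots,a_m$, and $a_i\ne a_j$ are joined when some line of $\mathcal{L}$ has one end in $S(a_i)$ and the other in $S(a_j)$. A cover associated to $\mathcal{X}$ is an open cover $\{U_1,\dots,U_m\}$ of $\mathcal{D}$ such that $q(S(a_i))\subset U_i$ for all $i$; for $i\neq j$, $U_i\cap U_j\ne\emptyset$ if and only if $a_i$ and $a_j$ are joined in the Whitehead graph; and $U_i\cap U_j\cap U_k=\emptyset$ for distinct $i,j,k$. The cover associated to the empty subtree is $\{\mathcal{D}\}$. A class in $\check{\mathrm{H}}{}^0(\mathcal{D},\mathbb{Z})$ is supported on $\mathcal{X}$ if it is the image of an element of $\check{\mathrm{H}}{}^0(\mathcal{U},\mathbb{Z})$ for some cover $\mathcal{U}$ associated to $\mathcal{X}$. Theorem. There is a computable function $N$ of $n$ and the list $(w_1,\dots,w_r)$ such that, for all $n$ and $w_1,\dots,w_r$,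 the abelian group $\check{\mathrm{H}}{}^0(\mathcal{D},\mathbb{Z})$ is generated by classes that are supported on subtrees of $\mathcal{T}$ with at most $N(n;w_1,\dots,w_r)$ vertices. -/

import Mathlib

open Set Filter Topology

/-! ### Čech cohomology in degree zero -/

/-- An open cover of a topological space, as a set of open subsets whose union is everything. -/
structure OpenCover (X : Type) [TopologicalSpace X] where
  sets : Set (Set X)
  isOpen : ∀ u ∈ sets, IsOpen u
  covers : ⋃₀ sets = Set.univ

namespace OpenCover

variable {X : Type} [TopologicalSpace X]

/-- Open covers are ordered by refinement: `𝒰 ≤ 𝒱` when `𝒱` refines `𝒰`. -/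
instance : Preorder (OpenCover X) where
  le 𝒰 𝒱 := ∀ v ∈ 𝒱.sets, ∃ u ∈ 𝒰.sets, v ⊆ u
  le_refl _ v hv := ⟨v, hv, subset_rfl⟩
  le_trans _ _ _ h₁ h₂ w hw :=
    let ⟨v, hv, hwv⟩ := h₂ w hw
    let ⟨u, hu, hvu⟩ := h₁ v hv
    ⟨u, hu, hwv.trans hvu⟩

noncomputable instance : DecidableEq (OpenCover X) := Classical.decEq _

/-- The vertices of the nerve: the nonempty members of the cover. -/
def Vertex (𝒰 : OpenCover X) : Type := {u : Set X // u ∈ 𝒰.sets ∧ u.Nonempty}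

/-- The (ordered) edges of the nerve: pairs of members that intersect. -/
def Edge (𝒰 : OpenCover X) : Type :=
  {p : 𝒰.Vertex × 𝒰.Vertex // (p.1.1 ∩ p.2.1).Nonempty}

/-- The coboundary `d⁰ : Č⁰(𝒰, ℤ) → Č¹(𝒰, ℤ)`. -/
def d0 (𝒰 : OpenCover X) : (𝒰.Vertex → ℤ) →+ (𝒰.Edge → ℤ) where
  toFun σ p := σ p.1.2 - σ p.1.1
  map_zero' := by funext p; simp
  map_add' σ τ := by funext p; simp only [Pi.add_apply]; ring

/-- `Ȟ⁰(𝒰, ℤ)`, the group of 0-cocycles of the nerve of `𝒰`. -/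
abbrev H0 (𝒰 : OpenCover X) : AddSubgroup (𝒰.Vertex → ℤ) := 𝒰.d0.ker

theorem mem_H0 {𝒰 : OpenCover X} {σ : 𝒰.Vertex → ℤ} :
    σ ∈ 𝒰.H0 ↔ ∀ u v : 𝒰.Vertex, (u.1 ∩ v.1).Nonempty → σ u = σ v := by
  constructor
  · intro h u v huv
    have := congrFun (AddMonoidHom.mem_ker.1 h) ⟨(u, v), huv⟩
    exact (sub_eq_zero.1 this).symm
  · intro h
    refine AddMonoidHom.mem_ker.2 (funext fun p => ?_)
    exact sub_eq_zero.2 (h _ _ p.2).symm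

theorem exists_vertex {𝒰 𝒱 : OpenCover X} (h : 𝒰 ≤ 𝒱) (v : 𝒱.Vertex) :
    ∃ u : 𝒰.Vertex, v.1 ⊆ u.1 :=
  let ⟨u, hu, hvu⟩ := h v.1 v.2.1
  ⟨⟨u, hu, v.2.2.mono hvu⟩, hvu⟩

/-- A refinement map on the vertices of the nerves. -/
noncomputable def refineVertex {𝒰 𝒱 : OpenCover X} (h : 𝒰 ≤ 𝒱) (v : 𝒱.Vertex) : 𝒰.Vertex :=
  (exists_vertex h v).choose

theorem subset_refineVertex {𝒰 𝒱 : OpenCover X} (h : 𝒰 ≤ 𝒱) (v : 𝒱.Vertex) :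
    v.1 ⊆ (refineVertex h v).1 :=
  (exists_vertex h v).choose_spec

/-- The map `Ȟ⁰(𝒰, ℤ) → Ȟ⁰(𝒱, ℤ)` induced by a refinement. -/
noncomputable def refine (𝒰 𝒱 : OpenCover X) (h : 𝒰 ≤ 𝒱) : 𝒰.H0 →+ 𝒱.H0 where
  toFun σ := ⟨fun v => σ.1 (refineVertex h v), mem_H0.2 fun u v huv =>
    mem_H0.1 σ.2 _ _ (huv.mono
      (inter_subset_inter (subset_refineVertex h u) (subset_refineVertex h v)))⟩
  map_zero' := rfl
  map_add' _ _ := rfl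

/-- The map induced by a refinement does not depend on the choice of the refinement map. -/
theorem refine_apply {𝒰 𝒱 : OpenCover X} (h : 𝒰 ≤ 𝒱) (σ : 𝒰.H0) (v : 𝒱.Vertex) (u : 𝒰.Vertex)
    (hvu : v.1 ⊆ u.1) : (refine 𝒰 𝒱 h σ).1 v = σ.1 u :=
  mem_H0.1 σ.2 _ _ (v.2.2.mono (subset_inter (subset_refineVertex h v) hvu))

instance : DirectedSystem (fun 𝒰 : OpenCover X => 𝒰.H0) fun 𝒰 𝒱 h => refine 𝒰 𝒱 h where
  map_self _ σ := Subtype.ext (funext fun v => refine_apply _ σ v v subset_rfl)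
  map_map _ _ _ h₁ h₂ σ := Subtype.ext (funext fun w =>
    (refine_apply (h₁.trans h₂) σ w _
      ((subset_refineVertex h₂ w).trans (subset_refineVertex h₁ _))).symm)

end OpenCover

/-- `Ȟ⁰(X, ℤ)`: the direct limit of `Ȟ⁰(𝒰, ℤ)` over all open covers, ordered by refinement. -/
abbrev CechH0 (X : Type) [TopologicalSpace X] : Type :=
  AddCommGroup.DirectLimit (fun 𝒰 : OpenCover X => 𝒰.H0) OpenCover.refine

/-- The canonical map `Ȟ⁰(𝒰, ℤ) → Ȟ⁰(X, ℤ)`. -/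
noncomputable def CechH0.of {X : Type} [TopologicalSpace X] (𝒰 : OpenCover X) :
    𝒰.H0 →+ CechH0 X :=
  AddCommGroup.DirectLimit.of (fun 𝒰 : OpenCover X => 𝒰.H0) OpenCover.refine 𝒰

/-! ### The tree, its boundary and the decomposition space -/

namespace LinePattern

/-- The Cayley graph of the free group of rank `n` with respect to its free basis. -/
def cayleyTree (n : ℕ) : SimpleGraph (FreeGroup (Fin n)) :=
  SimpleGraph.mulCayley (Set.range (FreeGroup.of (α := Fin n)))

/-- `v` lies on the geodesic `[x, y]` of the Cayley tree. The distance between vertices `g` and `h`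
is the word length of `g⁻¹ h`. -/
def OnGeodesic {n : ℕ} (x v y : FreeGroup (Fin n)) : Prop :=
  (x⁻¹ * v).norm + (v⁻¹ * y).norm = (x⁻¹ * y).norm

/-- The boundary at infinity of the free group of rank `n`: infinite reduced words (equivalently,
geodesic rays from the identity in the Cayley tree), with the topology of pointwise
convergence of letters. -/
abbrev Boundary (n : ℕ) : Type :=
  {ξ : ℕ → Fin n × Bool // ∀ k, (ξ k).1 = (ξ (k + 1)).1 → (ξ k).2 = (ξ (k + 1)).2}

/-- The `m`-th vertex of the geodesic ray from the identity to `ξ`. -/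
def ray {n : ℕ} (ξ : Boundary n) (m : ℕ) : FreeGroup (Fin n) :=
  FreeGroup.mk ((List.range m).map ξ.1)

/-- A family of vertices converges along a filter to the boundary point `ξ`: for each `m`,
it is eventually behind the `m`-th vertex of the ray to `ξ`, as seen from the identity. -/
def ConvergesTo {n : ℕ} {ι : Type} (l : Filter ι) (u : ι → FreeGroup (Fin n)) (ξ : Boundary n) :
    Prop :=
  ∀ m, ∀ᶠ k in l, OnGeodesic 1 (ray ξ m) (u k)

/-- `ξ` and `η` are the end points `l^{+∞}` and `l^{-∞}` of a line `l = {g wᵏ}ₖ`, with `w ∈ S`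
and `g ∈ F`, of the line pattern associated to `S`. -/
def IsLine {n : ℕ} (S : Set (FreeGroup (Fin n))) (ξ η : Boundary n) : Prop :=
  ∃ w ∈ S, ∃ g : FreeGroup (Fin n),
    ConvergesTo atTop (fun k : ℤ => g * w ^ k) ξ ∧ ConvergesTo atBot (fun k : ℤ => g * w ^ k) η

/-- The decomposition space: the quotient of the boundary by the equivalence relation generated by
identifying the two end points of each line of the pattern, with the quotient topology. -/
abbrev DecompositionSpace {n : ℕ} (S : Set (FreeGroup (Fin n))) : Type := Quot (IsLine S)

/-- The shadow of `v` from `x`: the boundary points `ξ` such that the geodesic from `x` to `ξ`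
contains `v`. -/
def shadow {n : ℕ} (x v : FreeGroup (Fin n)) : Set (Boundary n) :=
  {ξ | ∀ᶠ m in atTop, OnGeodesic x v (ray ξ m)}

/-! ### Whitehead graphs and the associated covers -/

/-- `X` is the vertex set of a finite (possibly empty) subtree of the Cayley tree. -/
def IsSubtree {n : ℕ} (X : Finset (FreeGroup (Fin n))) : Prop :=
  ((cayleyTree n).induce (X : Set (FreeGroup (Fin n)))).Preconnected

/-- The vertices of the Whitehead graph at `X`: the vertices of the tree adjacent to `X`. -/
def WhVertex {n : ℕ} (X : Finset (FreeGroup (Fin n))) : Type :=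
  {a : FreeGroup (Fin n) // a ∉ X ∧ ∃ x ∈ X, (cayleyTree n).Adj x a}

/-- The shadow of a vertex `a` adjacent to the subtree `X`, as seen from `X`. -/
def shadowFrom {n : ℕ} (X : Finset (FreeGroup (Fin n))) (a : WhVertex X) : Set (Boundary n) :=
  {ξ | ∀ x ∈ X, ξ ∈ shadow x a.1}

/-- The Whitehead graph at `X` of the line pattern associated to `S`: distinct `a` and `b` are
joined when some line of the pattern runs between them, that is, has one end behind `a` and the
other behind `b`. (Multiplicities of edges are not recorded.) -/
def whiteheadGraph {n : ℕ} (S : Set (FreeGroup (Fin n))) (X : Finset (FreeGroup (Fin n))) :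
    SimpleGraph (WhVertex X) :=
  SimpleGraph.fromRel fun a b =>
    ∃ ξ ∈ shadowFrom X a, ∃ η ∈ shadowFrom X b, IsLine S ξ η

/-- The family `U`, indexed by the vertices of the Whitehead graph at `X`, is an open cover of the
decomposition space associated to the nonempty subtree `X`. -/
structure IsAssociatedFamily {n : ℕ} (S : Set (FreeGroup (Fin n)))
    (X : Finset (FreeGroup (Fin n))) (U : WhVertex X → Set (DecompositionSpace S)) : Prop where
  isOpen : ∀ a, IsOpen (U a)
  covers : ⋃ a, U a = Set.univ
  image_shadow_subset : ∀ a, Quot.mk (IsLine S) '' shadowFrom X a ⊆ U a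
  inter_nonempty_iff : ∀ a b, a ≠ b →
    ((U a ∩ U b).Nonempty ↔ (whiteheadGraph S X).Adj a b)
  no_triple : ∀ a b c, a ≠ b → a ≠ c → b ≠ c → U a ∩ U b ∩ U c = ∅

/-- `𝒰` is a cover `𝒰_X` associated to the finite subtree `X`; the cover associated to the empty
subtree is the trivial one. -/
def IsAssociatedCover {n : ℕ} (S : Set (FreeGroup (Fin n))) (X : Finset (FreeGroup (Fin n)))
    (𝒰 : OpenCover (DecompositionSpace S)) : Prop :=
  (X = ∅ ∧ 𝒰.sets = {Set.univ}) ∨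
    (X.Nonempty ∧ ∃ U : WhVertex X → Set (DecompositionSpace S),
      IsAssociatedFamily S X U ∧ 𝒰.sets = Set.range U)

/-- The class `c` is supported on the subtree `X`: it is represented by a 0-cocycle on a cover
associated to `X`. -/
def IsSupportedOn {n : ℕ} (S : Set (FreeGroup (Fin n))) (X : Finset (FreeGroup (Fin n)))
    (c : CechH0 (DecompositionSpace S)) : Prop :=
  ∃ 𝒰 : OpenCover (DecompositionSpace S), IsAssociatedCover S X 𝒰 ∧
    ∃ σ : 𝒰.H0, CechH0.of 𝒰 σ = c

/-- The finite set of elements of the free group represented by a finite list of words; a letter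
`(i, true)` is the `i`-th basis element and `(i, false)` its inverse. -/
def elements {n : ℕ} (W : List (List (Fin n × Bool))) : Set (FreeGroup (Fin n)) :=
  {w | ∃ u ∈ W, FreeGroup.mk u = w}

/-- A finite list of words as an input to an algorithm: basis elements become natural numbers. -/
def encodeWords {n : ℕ} (W : List (List (Fin n × Bool))) : List (List (ℕ × Bool)) :=
  W.map fun u => u.map fun p => ((p.1 : ℕ), p.2)

end LinePattern

/-! A class in degree zero is a locally constant function on the decomposition space, that is, a
function `f` on the boundary that is constant on lines and, by compactness, depends only on the
first `m` letters for some `m`. The task is to cut `f` into pieces, each vanishing off the half-tree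
behind some vertex `v` and depending on boundedly many letters after `v`. A piece of depth `R` at
`v` is constant on the shadows seen from the ball of radius `R` about `v`, so its class is supported
on that ball (`IsPiece.exists_supported`).

The cutting is an induction on depth (`IsPiece.mem_closure`). Let `c` be a child of `v`. Suppose a
function `h` of bounded depth behind `c` is constant on lines inside that half-tree and agrees with
`f` on the ends of lines leaving it. Then `f - h`, extended by zero, is still constant on lines and
is a piece at `c`, of depth one less than `f`. Subtracting these corrections for all children leaves
a piece at `v` of bounded depth.

Such an `h` exists (`exists_bounded_extension`) as soon as `f` takes equal values on crossing ends
that are related at the bounded depth `R`, the relation being generated by sharing `R` letters after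
`c` and by being the two ends of a line. These relations shrink as `R` grows, and `f` respects the
one at its own depth; so it suffices that on crossing ends they become constant at a bounded depth.
Up to translation there are only `2n` half-trees, each with at most `P` crossing ends, where `P`
counts the positions on the words and their inverses. A chain at depth `R + 1` splits into chains at
depth `R` behind the children, linked by lines; hence relations that agree at depths `R` and `R + 1`
for all half-trees never change again (`Stable.succ`). They are therefore stable by depth `2n * P ^
2`, which is computable. -/

namespace LinePattern

/-! ### Reduced words, half-trees and convergence of vertices. -/

variable {n : ℕ}

/-! ### Geodesics from the identity are prefixes of reduced words -/

theorem toWord_mk_of_isReduced {L : List (Fin n × Bool)} (h : FreeGroup.IsReduced L) :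
    (FreeGroup.mk L).toWord = L := by
  rw [FreeGroup.toWord_mk, h.reduce_eq]

theorem toWord_mul_of_isReduced {a b : FreeGroup (Fin n)}
    (h : FreeGroup.IsReduced (a.toWord ++ b.toWord)) :
    (a * b).toWord = a.toWord ++ b.toWord := by
  rw [FreeGroup.toWord_mul, h.reduce_eq]

theorem toWord_mul_of_norm {a b : FreeGroup (Fin n)} (h : a.norm + b.norm = (a * b).norm) :
    (a * b).toWord = a.toWord ++ b.toWord :=
  (FreeGroup.toWord_mul_sublist a b).eq_of_length (by
    rw [List.length_append]; exact h.symm)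

theorem onGeodesic_one_iff {a b : FreeGroup (Fin n)} :
    OnGeodesic 1 a b ↔ a.toWord <+: b.toWord := by
  unfold OnGeodesic
  simp only [inv_one, one_mul]
  constructor
  · intro h
    have := toWord_mul_of_norm (a := a) (b := a⁻¹ * b) (by simpa using h)
    rw [mul_inv_cancel_left] at this
    exact ⟨_, this.symm⟩
  · rintro ⟨t, ht⟩
    have hr : FreeGroup.IsReduced t :=
      (FreeGroup.isReduced_toWord (x := b)).infix ⟨a.toWord, [], by simpa using ht⟩
    have hb : a⁻¹ * b = FreeGroup.mk t := by
      rw [inv_mul_eq_iff_eq_mul, ← FreeGroup.mk_toWord (x := b), ← ht, ← FreeGroup.mul_mk,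
        FreeGroup.mk_toWord]
    rw [hb]
    unfold FreeGroup.norm
    rw [toWord_mk_of_isReduced hr, ← ht, List.length_append]

theorem onGeodesic_iff {x v y : FreeGroup (Fin n)} :
    OnGeodesic x v y ↔ (x⁻¹ * v).toWord <+: (x⁻¹ * y).toWord := by
  rw [← onGeodesic_one_iff]
  simp [OnGeodesic, mul_assoc]

theorem eq_of_onGeodesic_of_norm {a b c : FreeGroup (Fin n)} (ha : OnGeodesic 1 a c)
    (hb : OnGeodesic 1 b c) (h : a.norm = b.norm) : a = b := by
  rw [onGeodesic_one_iff] at ha hb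
  exact FreeGroup.toWord_injective
    ((List.prefix_of_prefix_length_le ha hb h.le).eq_of_length h)

theorem onGeodesic_of_norm_le {a b c : FreeGroup (Fin n)} (ha : OnGeodesic 1 a c)
    (hb : OnGeodesic 1 b c) (h : a.norm ≤ b.norm) : OnGeodesic 1 a b := by
  rw [onGeodesic_one_iff] at *
  exact List.prefix_of_prefix_length_le ha hb h

theorem onGeodesic_one_trans {a b c : FreeGroup (Fin n)} (ha : OnGeodesic 1 a b)
    (hb : OnGeodesic 1 b c) : OnGeodesic 1 a c := by
  rw [onGeodesic_one_iff] at *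
  exact ha.trans hb

theorem onGeodesic_one_self (a : FreeGroup (Fin n)) : OnGeodesic 1 a a := by
  rw [onGeodesic_one_iff]

theorem onGeodesic_one_norm_le {a b : FreeGroup (Fin n)} (h : OnGeodesic 1 a b) :
    a.norm ≤ b.norm :=
  (onGeodesic_one_iff.1 h).length_le

/-- Multiplication by a letter either appends that letter or deletes the last letter. -/
theorem toWord_mul_letter (x : FreeGroup (Fin n)) (s : Fin n × Bool) :
    (x * FreeGroup.mk [s]).toWord = x.toWord ++ [s] ∨
      x.toWord = (x * FreeGroup.mk [s]).toWord ++ [(s.1, !s.2)] := by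
  rcases List.eq_nil_or_concat x.toWord with h | ⟨t, b, h⟩
  · left
    rw [toWord_mul_of_isReduced] <;> simp [h]
  · rw [List.concat_eq_append] at h
    have hred := FreeGroup.isReduced_toWord (x := x)
    have hs : (FreeGroup.mk [s]).toWord = [s] := toWord_mk_of_isReduced (by simp)
    by_cases hb : b.1 = s.1 → b.2 = s.2
    · left
      rw [toWord_mul_of_isReduced, hs]
      rw [hs, h]
      refine FreeGroup.IsReduced.append_overlap (h ▸ hred) ?_ (by simp)
      simpa [FreeGroup.IsReduced] using hb
    · right
      have hb' : b = (s.1, !s.2) := by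
        push Not at hb
        ext1
        · exact hb.1
        · have := hb.2
          revert this
          cases b.2 <;> cases s.2 <;> simp
      have hx : x * FreeGroup.mk [s] = FreeGroup.mk t := by
        rw [← FreeGroup.mk_toWord (x := x), h, hb', ← FreeGroup.mul_mk, mul_assoc,
          FreeGroup.mul_mk]
        have : FreeGroup.mk ([(s.1, !s.2)] ++ [s]) = 1 := by
          rw [FreeGroup.one_eq_mk]
          refine Quot.sound ?_
          have := @FreeGroup.Red.Step.not _ [] [] s.1 (!s.2)
          simpa using this
        rw [this, mul_one]
      rw [hx, toWord_mk_of_isReduced (hred.infix ⟨[], [b], by simp [h]⟩), h, hb']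

/-- Right multiplication by a letter changes a reduced word only at its end, so the half-tree behind
`v` can be entered only at `v`. -/
theorem eq_of_enter {v x : FreeGroup (Fin n)} {s : Fin n × Bool} (h : ¬ OnGeodesic 1 v x)
    (h' : OnGeodesic 1 v (x * FreeGroup.mk [s])) : x * FreeGroup.mk [s] = v := by
  rw [onGeodesic_one_iff] at *
  rcases toWord_mul_letter x s with e | e
  · rw [e, List.prefix_concat_iff] at h'
    rcases h' with h' | h'
    · exact FreeGroup.toWord_injective (e.trans h'.symm)
    · exact absurd h' h
  · exact absurd (h'.trans ⟨_, e.symm⟩) h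

theorem eq_of_exit {v x : FreeGroup (Fin n)} {s : Fin n × Bool} (h : OnGeodesic 1 v x)
    (h' : ¬ OnGeodesic 1 v (x * FreeGroup.mk [s])) : x = v := by
  have e : x * FreeGroup.mk [s] * FreeGroup.mk [(s.1, !s.2)] = x := by
    rw [mul_assoc, FreeGroup.mul_mk]
    have : FreeGroup.mk ([s] ++ [(s.1, !s.2)]) = 1 := by
      rw [FreeGroup.one_eq_mk]
      exact Quot.sound (by simpa using @FreeGroup.Red.Step.not _ [] [] s.1 s.2)
    rw [this, mul_one]
  rw [← e] at h ⊢
  exact eq_of_enter h' h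

/-! ### Lines that enter or leave the half-tree behind `v` pass through `v` -/

theorem exists_step {p : ℕ → Prop} {m : ℕ} (h0 : ¬ p 0) (hm : p m) :
    ∃ j < m, ¬ p j ∧ p (j + 1) := by
  induction m with
  | zero => exact absurd hm h0
  | succ k ih =>
    by_cases hk : p k
    · obtain ⟨j, hj, h⟩ := ih hk
      exact ⟨j, by omega, h⟩
    · exact ⟨k, by omega, hk, hm⟩

theorem mk_take_succ {u : List (Fin n × Bool)} {j : ℕ} (hj : j < u.length) :
    FreeGroup.mk (u.take (j + 1)) = FreeGroup.mk (u.take j) * FreeGroup.mk [u[j]] := by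
  rw [FreeGroup.mul_mk]
  simp

theorem exists_cross_word {v x : FreeGroup (Fin n)} {u : List (Fin n × Bool)}
    (h : ¬ (OnGeodesic 1 v x ↔ OnGeodesic 1 v (x * FreeGroup.mk u))) :
    ∃ j ≤ u.length, v = x * FreeGroup.mk (u.take j) := by
  by_cases hx : OnGeodesic 1 v x
  · have hx' : ¬ OnGeodesic 1 v (x * FreeGroup.mk u) := fun h' => h ⟨fun _ => h', fun _ => hx⟩
    obtain ⟨j, hj, h1, h2⟩ := exists_step
      (p := fun j => ¬ OnGeodesic 1 v (x * FreeGroup.mk (u.take j))) (m := u.length)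
      (by simpa [← FreeGroup.one_eq_mk] using hx) (by simpa using hx')
    rw [not_not] at h1
    rw [mk_take_succ hj, ← mul_assoc] at h2
    exact ⟨j, hj.le, (eq_of_exit h1 h2).symm⟩
  · have hx' : OnGeodesic 1 v (x * FreeGroup.mk u) := by
      by_contra h'; exact h ⟨fun h => absurd h hx, fun h => absurd h h'⟩
    obtain ⟨j, hj, h1, h2⟩ := exists_step
      (p := fun j => OnGeodesic 1 v (x * FreeGroup.mk (u.take j))) (m := u.length)
      (by simpa [← FreeGroup.one_eq_mk] using hx) (by simpa using hx')
    rw [mk_take_succ hj, ← mul_assoc] at h2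
    refine ⟨j + 1, hj, ?_⟩
    rw [mk_take_succ hj, ← mul_assoc]
    exact (eq_of_enter h1 h2).symm

/-- The path through the vertices `g w ^ k` spelled by `u` has to cross the edge leading to `v`.
Since `u` need not be reduced or cyclically reduced, the path may backtrack; `v` is therefore
located by a prefix of `u` and not by a geodesic. -/
theorem exists_cross {v g : FreeGroup (Fin n)} {u : List (Fin n × Bool)} {k₀ k₁ : ℤ}
    (h₀ : ¬ OnGeodesic 1 v (g * FreeGroup.mk u ^ k₀))
    (h₁ : OnGeodesic 1 v (g * FreeGroup.mk u ^ k₁)) :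
    ∃ k : ℤ, ∃ j ≤ u.length, v = g * FreeGroup.mk u ^ k * FreeGroup.mk (u.take j) := by
  by_contra! hc
  have step : ∀ k : ℤ, OnGeodesic 1 v (g * FreeGroup.mk u ^ k) ↔
      OnGeodesic 1 v (g * FreeGroup.mk u ^ (k + 1)) := by
    intro k
    by_contra h
    rw [zpow_add_one, ← mul_assoc] at h
    obtain ⟨j, hj, e⟩ := exists_cross_word h
    exact hc k j hj e
  have all : ∀ k : ℤ, OnGeodesic 1 v (g * FreeGroup.mk u ^ k) ↔
      OnGeodesic 1 v (g * FreeGroup.mk u ^ k₀) := by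
    intro k
    obtain ⟨d, rfl⟩ : ∃ d, k = k₀ + d := ⟨k - k₀, by ring⟩
    induction d using Int.induction_on with
    | zero => rw [add_zero]
    | succ i ih => rw [← add_assoc, ← step, ih]
    | pred i ih => rw [← ih, step, add_sub_assoc', sub_add_cancel]
  exact h₀ ((all k₁).1 h₁)

/-! ### Rays and cylinders -/

theorem isReduced_range (ξ : Boundary n) (m : ℕ) :
    FreeGroup.IsReduced ((List.range m).map ξ.1) := by
  unfold FreeGroup.IsReduced
  rw [List.isChain_iff_getElem]
  intro i hi
  simpa using ξ.2 i

theorem toWord_ray (ξ : Boundary n) (m : ℕ) : (ray ξ m).toWord = (List.range m).map ξ.1 :=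
  toWord_mk_of_isReduced (isReduced_range ξ m)

@[simp] theorem norm_ray (ξ : Boundary n) (m : ℕ) : (ray ξ m).norm = m := by
  simp [FreeGroup.norm, toWord_ray]

theorem ray_eq_ray_iff {ξ η : Boundary n} {m : ℕ} :
    ray ξ m = ray η m ↔ ∀ i < m, ξ.1 i = η.1 i := by
  rw [← FreeGroup.toWord_inj, toWord_ray, toWord_ray]
  simp

theorem ray_eq_mono {ξ η : Boundary n} {m m' : ℕ} (h : ray ξ m = ray η m) (hm : m' ≤ m) :
    ray ξ m' = ray η m' :=
  ray_eq_ray_iff.2 fun i hi => ray_eq_ray_iff.1 h i (by omega)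

theorem onGeodesic_ray (ξ : Boundary n) {m m' : ℕ} (h : m ≤ m') :
    OnGeodesic 1 (ray ξ m) (ray ξ m') := by
  rw [onGeodesic_one_iff, toWord_ray, toWord_ray]
  obtain ⟨k, rfl⟩ := Nat.exists_eq_add_of_le h
  rw [List.range_add, List.map_append]
  exact List.prefix_append _ _

theorem boundary_ext {ξ η : Boundary n} (h : ∀ m, ray ξ m = ray η m) : ξ = η :=
  Subtype.ext (funext fun i => ray_eq_ray_iff.1 (h (i + 1)) i (by omega))

/-- The boundary points whose ray from the identity passes through `v`. -/
def Cyl (v : FreeGroup (Fin n)) : Set (Boundary n) := {ξ | ray ξ v.norm = v}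

theorem mem_cyl {v : FreeGroup (Fin n)} {ξ : Boundary n} : ξ ∈ Cyl v ↔ ray ξ v.norm = v := Iff.rfl

theorem mem_cyl_ray {ξ η : Boundary n} {m : ℕ} : η ∈ Cyl (ray ξ m) ↔ ray η m = ray ξ m := by
  simp [Cyl]

theorem mem_cyl_iff {v : FreeGroup (Fin n)} {ξ : Boundary n} {m : ℕ} (h : v.norm ≤ m) :
    ξ ∈ Cyl v ↔ OnGeodesic 1 v (ray ξ m) := by
  constructor
  · intro hv
    rw [← (show ray ξ v.norm = v from hv)]
    exact onGeodesic_ray ξ h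
  · intro hv
    exact eq_of_onGeodesic_of_norm (onGeodesic_ray ξ h) hv (by simp)

theorem cyl_congr {v : FreeGroup (Fin n)} {ξ η : Boundary n} {m : ℕ} (h : v.norm ≤ m)
    (e : ray ξ m = ray η m) : ξ ∈ Cyl v ↔ η ∈ Cyl v := by
  rw [mem_cyl_iff h, mem_cyl_iff h, e]

theorem ConvergesTo.unique {ι : Type} {l : Filter ι} [l.NeBot] {u : ι → FreeGroup (Fin n)}
    {ξ η : Boundary n} (h : ConvergesTo l u ξ) (h' : ConvergesTo l u η) : ξ = η := by
  refine boundary_ext fun m => ?_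
  obtain ⟨k, h1, h2⟩ := ((h m).and (h' m)).exists
  exact eq_of_onGeodesic_of_norm h1 h2 (by simp)

theorem ConvergesTo.comp {ι κ : Type} {l : Filter ι} {l' : Filter κ} {u : ι → FreeGroup (Fin n)}
    {ξ : Boundary n} (h : ConvergesTo l u ξ) {φ : κ → ι} (hφ : Tendsto φ l' l) :
    ConvergesTo l' (u ∘ φ) ξ :=
  fun m => hφ.eventually (h m)

/-- Right translation moves vertices by a bounded amount and so preserves limits. -/
theorem ConvergesTo.mul_right {ι : Type} {l : Filter ι} {u : ι → FreeGroup (Fin n)}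
    {ξ : Boundary n} (h : ConvergesTo l u ξ) (p : FreeGroup (Fin n)) :
    ConvergesTo l (fun i => u i * p) ξ := by
  intro m
  filter_upwards [h (m + p.norm + 1)] with i hi
  by_contra hc
  have hm : OnGeodesic 1 (ray ξ m) (u i) :=
    onGeodesic_one_trans (onGeodesic_ray ξ (by omega)) hi
  -- If the path spelled by `p` left the half-tree behind `ray ξ m`, it would pass through `ray ξ
  -- m`, and `u i` would have length at most `m + p.norm`. The depth `m + p.norm + 1` excludes this.
  rw [← FreeGroup.mk_toWord (x := p)] at hc
  obtain ⟨j, hj, e⟩ := exists_cross_word (v := ray ξ m) (x := u i) (u := p.toWord)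
    (fun h => hc (h.1 hm))
  have h1 : (u i).norm ≤ m + p.norm := by
    have : u i = ray ξ m * (FreeGroup.mk (p.toWord.take j))⁻¹ := by rw [e]; group
    rw [this]
    refine (FreeGroup.norm_mul_le _ _).trans ?_
    rw [norm_ray, FreeGroup.norm_inv_eq]
    have := FreeGroup.norm_mk_le (L₁ := p.toWord.take j)
    have h2 : (p.toWord.take j).length ≤ p.toWord.length := by simp
    have h3 : p.toWord.length = p.norm := rfl
    omega
  have h2 := onGeodesic_one_norm_le hi
  rw [norm_ray] at h2
  omega

end LinePattern

/-! ### Lines of the pattern: a line is determined by one end, and few lines cross an edge. -/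

namespace LinePattern

variable {n : ℕ}

/-! ### Lines of the pattern and their ends -/

/-- The words of the list together with their formal inverses. -/
def symWords (W : List (List (Fin n × Bool))) : List (List (Fin n × Bool)) :=
  W ++ W.map FreeGroup.invRev

/-- `x` and `y` are the two ends, in either order, of a line of the pattern. -/
def Partner (W : List (List (Fin n × Bool))) (x y : Boundary n) : Prop :=
  ∃ u ∈ symWords W, ∃ g : FreeGroup (Fin n),
    ConvergesTo atTop (fun k : ℤ => g * FreeGroup.mk u ^ k) x ∧
      ConvergesTo atBot (fun k : ℤ => g * FreeGroup.mk u ^ k) y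

theorem convergesTo_invRev {l l' : Filter ℤ} (hl : Tendsto (fun k : ℤ => -k) l l')
    {g : FreeGroup (Fin n)} {u : List (Fin n × Bool)} {x : Boundary n}
    (h : ConvergesTo l' (fun k : ℤ => g * FreeGroup.mk u ^ k) x) :
    ConvergesTo l (fun k : ℤ => g * FreeGroup.mk (FreeGroup.invRev u) ^ k) x := by
  have := h.comp hl
  convert this using 2 with k
  simp [← FreeGroup.inv_mk]

theorem invRev_mem_symWords {W : List (List (Fin n × Bool))} {u : List (Fin n × Bool)}
    (h : u ∈ symWords W) : FreeGroup.invRev u ∈ symWords W := by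
  simp only [symWords, List.mem_append, List.mem_map] at h ⊢
  rcases h with h | ⟨w, hw, rfl⟩
  · exact Or.inr ⟨u, h, rfl⟩
  · rw [FreeGroup.invRev_invRev]; exact Or.inl hw

theorem Partner.symm {W : List (List (Fin n × Bool))} {x y : Boundary n} (h : Partner W x y) :
    Partner W y x := by
  obtain ⟨u, hu, g, h1, h2⟩ := h
  exact ⟨_, invRev_mem_symWords hu, g, convergesTo_invRev tendsto_neg_atTop_atBot h2,
    convergesTo_invRev tendsto_neg_atBot_atTop h1⟩

theorem partner_iff {W : List (List (Fin n × Bool))} {x y : Boundary n} :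
    Partner W x y ↔ IsLine (elements W) x y ∨ IsLine (elements W) y x := by
  have key : ∀ {x y : Boundary n}, IsLine (elements W) x y → Partner W x y := by
    rintro x y ⟨w, ⟨u, hu, rfl⟩, g, h⟩
    exact ⟨u, by simp [symWords, hu], g, h⟩
  constructor
  · rintro ⟨u, hu, g, h1, h2⟩
    simp only [symWords, List.mem_append, List.mem_map] at hu
    rcases hu with hu | ⟨w, hw, rfl⟩
    · exact Or.inl ⟨_, ⟨u, hu, rfl⟩, g, h1, h2⟩
    · refine Or.inr ⟨_, ⟨w, hw, rfl⟩, g, ?_, ?_⟩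
      · simpa using convergesTo_invRev tendsto_neg_atTop_atBot h2
      · simpa using convergesTo_invRev tendsto_neg_atBot_atTop h1
  · rintro (h | h)
    · exact key h
    · exact (key h).symm

/-- A subsequence along an arithmetic progression keeps the ends, as does right translation by `p`;
the sign of `a` decides whether the two ends are exchanged. -/
theorem convergesTo_subsequence {g p r c w : FreeGroup (Fin n)} {k a : ℤ} (ha : a ≠ 0)
    (e : ∀ t : ℤ, r * c ^ t = g * w ^ (k + a * t) * p) {x y : Boundary n}
    (hx : ConvergesTo atTop (fun k : ℤ => g * w ^ k) x)
    (hy : ConvergesTo atBot (fun k : ℤ => g * w ^ k) y) :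
    (ConvergesTo atTop (fun t : ℤ => r * c ^ t) x ∧ ConvergesTo atBot (fun t : ℤ => r * c ^ t) y) ∨
    (ConvergesTo atTop (fun t : ℤ => r * c ^ t) y ∧
      ConvergesTo atBot (fun t : ℤ => r * c ^ t) x) := by
  have key : ∀ {l l' : Filter ℤ} {z : Boundary n},
      ConvergesTo l' (fun k : ℤ => g * w ^ k) z → Tendsto (fun t : ℤ => a * t) l l' →
      (Tendsto (fun t : ℤ => k + t) l' l') → ConvergesTo l (fun t : ℤ => r * c ^ t) z := by
    intro l l' z h h1 h2
    simp only [e]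
    exact (h.comp (h2.comp h1)).mul_right p
  have top := tendsto_atTop_add_const_left (atTop : Filter ℤ) k tendsto_id
  have bot := tendsto_atBot_add_const_left (atBot : Filter ℤ) k tendsto_id
  have mulTop : ∀ {b : ℤ}, 0 < b → Tendsto (fun t : ℤ => b * t) atTop atTop :=
    fun hb => tendsto_id.const_mul_atTop' hb
  have mulBot : ∀ {b : ℤ}, 0 < b → Tendsto (fun t : ℤ => b * t) atBot atBot := fun hb => by
    simpa [Function.comp_def] using
      tendsto_neg_atTop_atBot.comp ((mulTop hb).comp tendsto_neg_atBot_atTop)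
  rcases lt_or_gt_of_ne ha with ha | ha
  · right
    have ha' : 0 < -a := by omega
    refine ⟨key hy ?_ bot, key hx ?_ top⟩
    · simpa [Function.comp_def] using tendsto_neg_atTop_atBot.comp (mulTop ha')
    · simpa [Function.comp_def] using tendsto_neg_atBot_atTop.comp (mulBot ha')
  · exact Or.inl ⟨key hx (mulTop ha) top, key hy (mulBot ha) bot⟩

theorem exists_ray_eq {g : FreeGroup (Fin n)} {u : List (Fin n × Bool)} {x : Boundary n}
    (hx : ConvergesTo atTop (fun k : ℤ => g * FreeGroup.mk u ^ k) x) {m : ℕ} (hm : g.norm < m) :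
    ∃ k : ℤ, ∃ j ≤ u.length, ray x m = g * FreeGroup.mk u ^ k * FreeGroup.mk (u.take j) := by
  obtain ⟨k₁, h₁⟩ := (hx m).exists
  refine exists_cross (k₀ := 0) (fun h => ?_) h₁
  have := onGeodesic_one_norm_le h
  simp at this
  omega

theorem mul_zpow_of_labels {r r' g w p : FreeGroup (Fin n)} {k l : ℤ} (h : r = g * w ^ k * p)
    (h' : r' = g * w ^ l * p) (t : ℤ) :
    r * (r⁻¹ * r') ^ t = g * w ^ (k + (l - k) * t) * p := by
  have hc : r⁻¹ * r' = p⁻¹ * w ^ (l - k) * p⁻¹⁻¹ := by rw [h, h', zpow_sub]; group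
  rw [hc, conj_zpow, h, ← zpow_mul, zpow_add]
  group

/-- Two lines with a common end have the same other end. -/
theorem partner_unique {W : List (List (Fin n × Bool))} {x y z : Boundary n}
    (hy : Partner W x y) (hz : Partner W x z) : y = z := by
  obtain ⟨u, -, g, hx, hy⟩ := hy
  obtain ⟨u', -, g', hx', hz⟩ := hz
  -- Beyond length `g.norm + g'.norm` neither base point is behind the vertex of the ray, so both
  -- lines must pass through that vertex.
  have h1 : ∀ i : ℕ, ∃ k : ℤ, ∃ j : Fin (u.length + 1), ray x (g.norm + g'.norm + 1 + i) =
      g * FreeGroup.mk u ^ k * FreeGroup.mk (u.take j) := fun i => by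
    obtain ⟨k, j, hj, e⟩ := exists_ray_eq hx (m := g.norm + g'.norm + 1 + i) (by omega)
    exact ⟨k, ⟨j, by omega⟩, e⟩
  have h2 : ∀ i : ℕ, ∃ k : ℤ, ∃ j : Fin (u'.length + 1), ray x (g.norm + g'.norm + 1 + i) =
      g' * FreeGroup.mk u' ^ k * FreeGroup.mk (u'.take j) := fun i => by
    obtain ⟨k, j, hj, e⟩ := exists_ray_eq hx' (m := g.norm + g'.norm + 1 + i) (by omega)
    exact ⟨k, ⟨j, by omega⟩, e⟩
  choose k j hj using h1
  choose k' j' hj' using h2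
  -- Pigeonhole on pairs of positions: two vertices `r`, `r'` of the ray sit at the same position of
  -- `u` and at the same position of `u'`. The sequence `r * (r⁻¹ * r') ^ t` is then a translated
  -- subsequence of both lines, so the lines share both ends.
  obtain ⟨i, i', hne, heq⟩ := Finite.exists_ne_map_eq_of_infinite fun i => (j i, j' i)
  simp only [Prod.mk.injEq] at heq
  have e1 := hj i
  have e2 := hj i'
  have e3 := hj' i
  have e4 := hj' i'
  rw [← heq.1] at e2
  rw [← heq.2] at e4
  have hr : ray x (g.norm + g'.norm + 1 + i) ≠ ray x (g.norm + g'.norm + 1 + i') := by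
    intro h
    have := congrArg FreeGroup.norm h
    simp only [norm_ray] at this
    omega
  have ha : k i' - k i ≠ 0 := fun h => hr (by rw [e1, e2, sub_eq_zero.1 h])
  have hb : k' i' - k' i ≠ 0 := fun h => hr (by rw [e3, e4, sub_eq_zero.1 h])
  rcases convergesTo_subsequence ha (mul_zpow_of_labels e1 e2) hx hy with ⟨p1, p2⟩ | ⟨p1, p2⟩ <;>
  rcases convergesTo_subsequence hb (mul_zpow_of_labels e3 e4) hx' hz with ⟨q1, q2⟩ | ⟨q1, q2⟩
  · exact p2.unique q2
  · exact (p2.unique q2).trans (p1.unique q1)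
  · exact (p1.unique q1).trans (p2.unique q2)
  · exact p1.unique q1

/-! ### Lines that cross an edge -/

/-- The ends behind `v` of (half-)lines that enter the half-tree behind `v`. -/
def crossing (W : List (List (Fin n × Bool))) (v : FreeGroup (Fin n)) : Set (Boundary n) :=
  {x | x ∈ Cyl v ∧ ∃ u ∈ symWords W, ∃ g : FreeGroup (Fin n),
    ConvergesTo atTop (fun k : ℤ => g * FreeGroup.mk u ^ k) x ∧
      ∃ k : ℤ, ¬ OnGeodesic 1 v (g * FreeGroup.mk u ^ k)}

/-- `crossing` asks only for one vertex `g w ^ k` outside the half-tree, so it may also contain ends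
of lines with both ends behind `v`. The surplus is harmless: what matters is that it contains the
ends of lines that leave, is finite, and is inherited by half-trees further out. -/
theorem mem_crossing_of_partner {W : List (List (Fin n × Bool))} {v : FreeGroup (Fin n)}
    {x y : Boundary n} (h : Partner W x y) (hx : x ∈ Cyl v) (hy : y ∉ Cyl v) :
    x ∈ crossing W v := by
  obtain ⟨u, hu, g, h1, h2⟩ := h
  refine ⟨hx, u, hu, g, h1, ?_⟩
  obtain ⟨k, hk⟩ := (h2 v.norm).exists
  exact ⟨k, fun h => hy (eq_of_onGeodesic_of_norm hk h (by simp))⟩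

theorem crossing_subset_of_onGeodesic {W : List (List (Fin n × Bool))} {v c : FreeGroup (Fin n)}
    (h : OnGeodesic 1 v c) {x : Boundary n} (hx : x ∈ crossing W v) (hc : x ∈ Cyl c) :
    x ∈ crossing W c := by
  obtain ⟨-, u, hu, g, h1, k, hk⟩ := hx
  exact ⟨hc, u, hu, g, h1, k, fun h' => hk (onGeodesic_one_trans h h')⟩

/-- The positions at which a line can pass through a given vertex. -/
def positions (W : List (List (Fin n × Bool))) : List (List (Fin n × Bool) × ℕ) :=
  (symWords W).flatMap fun u => (List.range (u.length + 1)).map fun j => (u, j)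

/-- The line passes through `v`, so its base point can be moved to `v` times the inverse of a prefix
of `u`. The end is then determined by `v` and a position, which bounds the number of crossing ends
uniformly in `v`. -/
theorem exists_position {W : List (List (Fin n × Bool))} {v : FreeGroup (Fin n)}
    {x : Boundary n} (h : x ∈ crossing W v) : ∃ l ∈ positions W,
      ConvergesTo atTop
        (fun k : ℤ => v * (FreeGroup.mk (l.1.take l.2))⁻¹ * FreeGroup.mk l.1 ^ k) x := by
  obtain ⟨hx, u, hu, g, h1, k₀, hk₀⟩ := h
  obtain ⟨k₁, hk₁⟩ := (h1 v.norm).exists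
  rw [show ray x v.norm = v from hx] at hk₁
  obtain ⟨k, j, hj, e⟩ := exists_cross hk₀ hk₁
  refine ⟨(u, j), ?_, ?_⟩
  · simp only [positions, List.mem_flatMap, List.mem_map, List.mem_range]
    exact ⟨u, hu, j, by omega, rfl⟩
  · have := h1.comp (tendsto_atTop_add_const_left (atTop : Filter ℤ) k tendsto_id)
    convert this using 2 with i
    simp only [Function.comp, id, zpow_add]
    rw [e]
    group

theorem crossing_finite_and_ncard_le (W : List (List (Fin n × Bool))) (v : FreeGroup (Fin n)) :
    (crossing W v).Finite ∧ (crossing W v).ncard ≤ (positions W).length := by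
  classical
  choose! f hf hf' using fun (x : Boundary n) (h : x ∈ crossing W v) => exists_position h
  have maps : ∀ x ∈ crossing W v, f x ∈ ((positions W).toFinset : Set _) := fun x hx => by
    simpa using hf x hx
  have inj : InjOn f (crossing W v) := by
    intro x hx y hy e
    have h1 := hf' x hx
    rw [e] at h1
    exact h1.unique (hf' y hy)
  refine ⟨Set.Finite.of_injOn maps inj (Finset.finite_toSet _), ?_⟩
  refine (Set.ncard_le_ncard_of_injOn f maps inj).trans ?_
  rw [Set.ncard_coe_finset]
  exact List.toFinset_card_le _

theorem crossing_finite (W : List (List (Fin n × Bool))) (v : FreeGroup (Fin n)) :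
    (crossing W v).Finite := (crossing_finite_and_ncard_le W v).1

/-- Only finitely many lines have ends that differ among their first `m` letters. -/
theorem finite_partner_ray_ne (W : List (List (Fin n × Bool))) (m : ℕ) :
    {x : Boundary n | ∃ y, Partner W x y ∧ ray x m ≠ ray y m}.Finite := by
  have hfin : (range fun x : Boundary n => ray x m).Finite := by
    refine Set.Finite.subset ((List.finite_length_eq (Fin n × Bool) m).image FreeGroup.mk) ?_
    rintro _ ⟨x, rfl⟩
    exact ⟨_, by simp, rfl⟩
  refine (hfin.biUnion fun v _ => crossing_finite W v).subset ?_
  rintro x ⟨y, h, hne⟩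
  exact mem_biUnion ⟨x, rfl⟩
    (mem_crossing_of_partner h (mem_cyl_ray.2 rfl) fun h' => hne (mem_cyl_ray.1 h').symm)

end LinePattern

/-! ### Translation of half-trees and stabilization of the relations on crossing ends. -/

namespace LinePattern

variable {n : ℕ}

/-! ### Translation between half-trees -/

theorem toWord_eq_append {t u : FreeGroup (Fin n)} (h : OnGeodesic 1 t u) :
    u.toWord = t.toWord ++ (t⁻¹ * u).toWord := by
  have := toWord_mul_of_norm (a := t) (b := t⁻¹ * u) (by simpa [OnGeodesic] using h)
  rwa [mul_inv_cancel_left] at this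

/-- Delete the first `k` letters of an infinite reduced word. -/
def dropLetters (k : ℕ) (x : Boundary n) : Boundary n :=
  ⟨fun i => x.1 (k + i), fun i => x.2 (k + i)⟩

theorem toWord_ray_add (x : Boundary n) (k m : ℕ) :
    (ray x (k + m)).toWord = (ray x k).toWord ++ (ray (dropLetters k x) m).toWord := by
  simp only [toWord_ray, List.range_add, List.map_append, List.map_map]
  rfl

theorem ray_dropLetters (x : Boundary n) (k m : ℕ) :
    ray (dropLetters k x) m = (ray x k)⁻¹ * ray x (k + m) := by
  rw [eq_inv_mul_iff_mul_eq, ← FreeGroup.mk_toWord (x := ray x (k + m)), toWord_ray_add,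
    ← FreeGroup.mul_mk, FreeGroup.mk_toWord, FreeGroup.mk_toWord]

theorem ConvergesTo.dropLetters {ι : Type} {l : Filter ι} {u : ι → FreeGroup (Fin n)}
    {x : Boundary n} (h : ConvergesTo l u x) (k : ℕ) :
    ConvergesTo l (fun i => (ray x k)⁻¹ * u i) (dropLetters k x) := by
  intro m
  filter_upwards [h (k + m)] with i hi
  have h1 := toWord_eq_append (onGeodesic_one_trans (onGeodesic_ray x (Nat.le_add_right k m)) hi)
  rw [onGeodesic_one_iff] at hi ⊢
  rwa [toWord_ray_add, h1, List.prefix_append_right_inj] at hi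

theorem toWord_mul_of_onGeodesic {t g : FreeGroup (Fin n)} {x : Boundary n} {k m : ℕ}
    (ht : t = ray x k) (h : OnGeodesic 1 (ray (dropLetters k x) (m + 1)) g) :
    (t * g).toWord = t.toWord ++ g.toWord := by
  apply toWord_mul_of_isReduced
  obtain ⟨r, hr⟩ := onGeodesic_one_iff.1 h
  rw [← hr]
  have h1 : FreeGroup.IsReduced (t.toWord ++ (ray (dropLetters k x) (m + 1)).toWord) := by
    rw [ht, ← toWord_ray_add]
    exact FreeGroup.isReduced_toWord
  rw [← List.append_assoc]
  refine h1.append_overlap (hr ▸ FreeGroup.isReduced_toWord) ?_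
  intro h0
  have := congrArg List.length h0
  simp [toWord_ray] at this

theorem ConvergesTo.of_dropLetters {ι : Type} {l : Filter ι} {u : ι → FreeGroup (Fin n)}
    {x : Boundary n} {k : ℕ} (h : ConvergesTo l u (LinePattern.dropLetters k x)) :
    ConvergesTo l (fun i => ray x k * u i) x := by
  intro m
  -- One letter beyond `m` guarantees a letter at the junction with `ray x k`, so that nothing
  -- cancels there even when `m = 0`.
  filter_upwards [h (m + 1)] with i hi
  refine onGeodesic_one_trans (onGeodesic_ray x (show m ≤ k + (m + 1) by omega)) ?_
  rw [onGeodesic_one_iff, toWord_mul_of_onGeodesic rfl hi, toWord_ray_add,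
    List.prefix_append_right_inj, ← onGeodesic_one_iff]
  exact hi

theorem partner_dropLetters_iff {W : List (List (Fin n × Bool))} {x y : Boundary n} {k : ℕ}
    (h : ray x k = ray y k) :
    Partner W (dropLetters k x) (dropLetters k y) ↔ Partner W x y := by
  constructor
  · rintro ⟨u, hu, g, h1, h2⟩
    refine ⟨u, hu, ray x k * g, ?_, ?_⟩
    · simpa only [mul_assoc] using h1.of_dropLetters
    · simpa only [mul_assoc, h] using h2.of_dropLetters
  · rintro ⟨u, hu, g, h1, h2⟩
    refine ⟨u, hu, (ray x k)⁻¹ * g, ?_, ?_⟩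
    · simpa only [mul_assoc] using h1.dropLetters k
    · simpa only [mul_assoc, h] using h2.dropLetters k

theorem ray_dropLetters_eq_iff {x y : Boundary n} {k m : ℕ} (h : ray x k = ray y k) :
    ray (dropLetters k x) m = ray (dropLetters k y) m ↔ ray x (k + m) = ray y (k + m) := by
  rw [ray_dropLetters, ray_dropLetters, h, mul_right_inj]

/-! ### The relation on a half-tree that a function of bounded depth respects -/

/-- Two boundary points behind `v` that agree on `R` letters after `v` or are the two ends of a
line. -/
def Step (W : List (List (Fin n × Bool))) (v : FreeGroup (Fin n)) (R : ℕ) (x y : Boundary n) :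
    Prop :=
  x ∈ Cyl v ∧ y ∈ Cyl v ∧ (ray x (v.norm + R) = ray y (v.norm + R) ∨ Partner W x y)

/-- The equivalence relation generated by `Step`. -/
def Rel (W : List (List (Fin n × Bool))) (v : FreeGroup (Fin n)) (R : ℕ) :
    Boundary n → Boundary n → Prop :=
  Relation.ReflTransGen (Step W v R)

variable {W : List (List (Fin n × Bool))} {v : FreeGroup (Fin n)} {R : ℕ} {x y z : Boundary n}

theorem Step.symm (h : Step W v R x y) : Step W v R y x :=
  ⟨h.2.1, h.1, h.2.2.imp Eq.symm Partner.symm⟩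

theorem Rel.symm (h : Rel W v R x y) : Rel W v R y x :=
  (@Relation.ReflTransGen.stdSymm _ _ ⟨fun _ _ h => Step.symm h⟩).symm _ _ h

theorem Rel.trans (h : Rel W v R x y) (h' : Rel W v R y z) : Rel W v R x z :=
  Relation.ReflTransGen.trans h h'

theorem Rel.of_le {R' : ℕ} (hR : R' ≤ R) (h : Rel W v R x y) : Rel W v R' x y :=
  Relation.ReflTransGen.mono (r := Step W v R) (p := Step W v R')
    (fun _ _ h => ⟨h.1, h.2.1, h.2.2.imp_left fun e => ray_eq_mono e (by omega)⟩) _ _ h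

theorem Rel.of_child {c : FreeGroup (Fin n)} (hc : OnGeodesic 1 v c) (hn : c.norm = v.norm + 1)
    (h : Rel W c R x y) : Rel W v (R + 1) x y := by
  have sub : ∀ {x : Boundary n}, x ∈ Cyl c → x ∈ Cyl v := fun {x} hx => by
    rw [mem_cyl_iff (le_refl _)] at hx
    rw [mem_cyl_iff (show v.norm ≤ c.norm by omega)]
    exact onGeodesic_one_trans hc hx
  refine Relation.ReflTransGen.mono (r := Step W c R) (p := Step W v (R + 1))
    (fun _ _ h => ⟨sub h.1, sub h.2.1, h.2.2.imp_left fun e => ?_⟩) _ _ h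
  rwa [show v.norm + (R + 1) = c.norm + R by omega]

/-- At depth `R` the relations on the crossing ends have stopped changing. -/
def Stable (W : List (List (Fin n × Bool))) (R : ℕ) : Prop :=
  ∀ v ≠ 1, ∀ x ∈ crossing W v, ∀ y ∈ crossing W v, Rel W v R x y → Rel W v (R + 1) x y

/-- Points sharing `R + 1` letters after `v` lie behind the same child, so a chain changes child
only along a line, whose ends are crossing ends of the two children. Each stretch inside a child
thus joins crossing ends of that child at depth `R`; stability refines it to depth `R + 1` there,
which is depth `R + 2` after `v`. -/
theorem Stable.succ (h : Stable W R) : Stable W (R + 1) := by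
  intro v hv x hx y hy hxy
  let c : Boundary n → FreeGroup (Fin n) := fun y => ray y (v.norm + 1)
  have hcn : ∀ y, (c y).norm = v.norm + 1 := fun y => norm_ray _ _
  have hc1 : ∀ y, c y ≠ 1 := fun y e => by
    have := hcn y
    rw [e] at this
    simp at this
  have hvc : ∀ {y}, y ∈ Cyl v → OnGeodesic 1 v (c y) := fun {y} hy => by
    rwa [← mem_cyl_iff (by omega)]
  have hyc : ∀ y, y ∈ Cyl (c y) := fun y => mem_cyl_ray.2 rfl
  -- Here `z` is the point where the chain last entered the child containing `y`, initially `x`. The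
  -- part up to `z` is already refined; the part from `z` to `y` awaits the next exit.
  have key : ∀ y, Rel W v (R + 1) x y →
      y ∈ Cyl v ∧ ∃ z ∈ crossing W (c y), Rel W v (R + 2) x z ∧ Rel W (c y) R z y := by
    intro y hxy
    induction hxy with
    | refl =>
      exact ⟨hx.1, x, crossing_subset_of_onGeodesic (hvc hx.1) hx (hyc x), .refl, .refl⟩
    | @tail y y' _ hs ih =>
      obtain ⟨hy, z, hz, hxz, hzy⟩ := ih
      refine ⟨hs.2.1, ?_⟩
      by_cases hcc : c y = c y'
      · refine ⟨z, hcc ▸ hz, hxz, hcc ▸ hzy.tail ⟨hyc y, hcc ▸ hyc y', ?_⟩⟩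
        rw [hcn]
        exact hs.2.2.imp_left fun e => by rwa [show v.norm + 1 + R = v.norm + (R + 1) by omega]
      · have hp : Partner W y y' := by
          refine hs.2.2.resolve_left fun e => hcc (ray_eq_mono e (by omega))
        have h1 : y ∈ crossing W (c y) :=
          mem_crossing_of_partner hp (hyc y) fun h' => hcc (mem_cyl_ray.1 h').symm
        have h2 : y' ∈ crossing W (c y') :=
          mem_crossing_of_partner hp.symm (hyc y') fun h' => hcc (mem_cyl_ray.1 h')
        refine ⟨y', h2, ?_, .refl⟩
        refine (hxz.trans ((h _ (hc1 y) z hz y h1 hzy).of_child (hvc hy) (hcn y))).tail ?_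
        exact ⟨hy, hs.2.1, Or.inr hp⟩
  obtain ⟨hyv, z, hz, hxz, hzy⟩ := key y hxy
  exact hxz.trans ((h _ (hc1 y) z hz y
    (crossing_subset_of_onGeodesic (hvc hyv) hy (hyc y)) hzy).of_child (hvc hyv) (hcn y))

theorem Stable.of_le {R' : ℕ} (h : Stable W R) (hR : R ≤ R') : Stable W R' :=
  Nat.le_induction h (fun _ _ h => h.succ) R' hR

theorem Stable.rel_of_rel (h : Stable W R) (hv : v ≠ 1) (hx : x ∈ crossing W v)
    (hy : y ∈ crossing W v) (hxy : Rel W v R x y) (R' : ℕ) : Rel W v R' x y := by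
  rcases le_total R R' with hR | hR
  · induction R', hR using Nat.le_induction with
    | base => exact hxy
    | succ k hk ih => exact h.of_le hk v hv x hx y hy ih
  · exact hxy.of_le hR

/-! ### Stabilization within a bounded depth -/

theorem exists_parent (hv : v ≠ 1) :
    ∃ t s, v.toWord = FreeGroup.toWord t ++ [s] ∧ v = t * FreeGroup.mk [s] := by
  rcases List.eq_nil_or_concat v.toWord with h | ⟨L, s, h⟩
  · exact absurd (FreeGroup.toWord_eq_nil_iff.1 h) hv
  · rw [List.concat_eq_append] at h
    have hL : (FreeGroup.mk L).toWord = L := toWord_mk_of_isReduced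
      ((FreeGroup.isReduced_toWord (x := v)).infix ⟨[], [s], by simp [h]⟩)
    refine ⟨FreeGroup.mk L, s, by rw [hL, h], ?_⟩
    rw [FreeGroup.mul_mk, ← h, FreeGroup.mk_toWord]

theorem norm_mk_singleton (s : Fin n × Bool) : (FreeGroup.mk [s]).norm = 1 := by
  simp [FreeGroup.norm]

theorem norm_parent {t : FreeGroup (Fin n)} {s : Fin n × Bool}
    (ht : v.toWord = t.toWord ++ [s]) : v.norm = t.norm + 1 := by simp [FreeGroup.norm, ht]

theorem ray_of_mem_cyl_child {t : FreeGroup (Fin n)} {s : Fin n × Bool}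
    (ht : v.toWord = t.toWord ++ [s])
    (hx : x ∈ Cyl v) : ray x t.norm = t := by
  refine eq_of_onGeodesic_of_norm (c := v) ?_ (onGeodesic_one_iff.2 ⟨_, ht.symm⟩) (by simp)
  rw [← show ray x v.norm = v from hx]
  exact onGeodesic_ray x (by rw [norm_parent ht]; omega)

theorem dropLetters_mem_cyl {t : FreeGroup (Fin n)} {s : Fin n × Bool}
    (ht : v.toWord = t.toWord ++ [s]) (htv : v = t * FreeGroup.mk [s])
    (hx : x ∈ Cyl v) :
    dropLetters t.norm x ∈ Cyl (FreeGroup.mk [s]) := by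
  have hx' : ray x v.norm = v := hx
  rw [mem_cyl, norm_mk_singleton, ray_dropLetters, ray_of_mem_cyl_child ht hx,
    ← norm_parent ht, hx', htv, inv_mul_cancel_left]

/-- Prepend the word of `t` to `z`. The first letter of `z` is `s`, and the word of `t` followed by
`s` is reduced, so nothing cancels. -/
theorem exists_dropLetters_eq {t : FreeGroup (Fin n)} {s : Fin n × Bool}
    (ht : v.toWord = t.toWord ++ [s])
    (hz : z ∈ Cyl (FreeGroup.mk [s])) :
    ∃ x ∈ Cyl v, dropLetters t.norm x = z := by
  have hz0 : z.1 0 = s := by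
    have : ray z (FreeGroup.mk [s]).norm = FreeGroup.mk [s] := hz
    rw [norm_mk_singleton, ← FreeGroup.toWord_inj, toWord_ray] at this
    simpa using this
  let L := t.toWord
  have hlen : t.norm = L.length := rfl
  have hred : FreeGroup.IsReduced (L ++ [s]) := ht ▸ FreeGroup.isReduced_toWord
  have hred' := List.isChain_iff_getElem.1 hred
  let x : Boundary n := ⟨fun i => if h : i < L.length then L[i] else z.1 (i - L.length), by
    intro k
    by_cases h1 : k + 1 < L.length
    · have := hred' k (by simp; omega)
      simpa [h1, show k < L.length by omega, List.getElem_append] using this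
    · by_cases h2 : k < L.length
      · have hk : k + 1 = L.length := by omega
        have := hred' k (by simp; omega)
        simpa [h1, h2, List.getElem_append, hz0, hk] using this
      · have hk : k + 1 - L.length = (k - L.length) + 1 := by omega
        simpa [h1, h2, hk] using z.2 (k - L.length)⟩
  have hxz : dropLetters t.norm x = z := by
    refine Subtype.ext (funext fun i => ?_)
    simp [dropLetters, x, hlen]
  refine ⟨x, ?_, hxz⟩
  have hxt : ray x t.norm = t := by
    rw [← FreeGroup.toWord_inj, toWord_ray, hlen]
    refine List.ext_getElem (by simp; rfl) fun i h1 h2 => ?_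
    simp only [List.length_map, List.length_range] at h1
    simp [x, h1, L]
  rw [mem_cyl, ← FreeGroup.toWord_inj, norm_parent ht, toWord_ray_add, hxz, hxt, ht,
    toWord_ray]
  simp [hz0]

theorem step_dropLetters_iff {t : FreeGroup (Fin n)} {s : Fin n × Bool}
    (ht : v.toWord = t.toWord ++ [s]) (htv : v = t * FreeGroup.mk [s])
    (hx : x ∈ Cyl v) (hy : y ∈ Cyl v) :
    Step W (FreeGroup.mk [s]) R (dropLetters t.norm x) (dropLetters t.norm y) ↔
      Step W v R x y := by
  have e : ray x t.norm = ray y t.norm := by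
    rw [ray_of_mem_cyl_child ht hx, ray_of_mem_cyl_child ht hy]
  have h1 := dropLetters_mem_cyl ht htv hx
  have h2 := dropLetters_mem_cyl ht htv hy
  simp only [Step, hx, hy, h1, h2, true_and, partner_dropLetters_iff e, norm_mk_singleton,
    ray_dropLetters_eq_iff e]
  rw [norm_parent ht, add_assoc]

theorem dropLetters_injOn {t : FreeGroup (Fin n)} {s : Fin n × Bool}
    (ht : v.toWord = t.toWord ++ [s]) : InjOn (dropLetters t.norm) (Cyl v) := by
  intro x hx y hy h
  have e : ray x t.norm = ray y t.norm := by
    rw [ray_of_mem_cyl_child ht hx, ray_of_mem_cyl_child ht hy]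
  refine boundary_ext fun m => ray_eq_mono (m := t.norm + m) ?_ (by omega)
  rw [← ray_dropLetters_eq_iff e, h]

theorem rel_dropLetters_iff {t : FreeGroup (Fin n)} {s : Fin n × Bool}
    (ht : v.toWord = t.toWord ++ [s]) (htv : v = t * FreeGroup.mk [s])
    (hx : x ∈ Cyl v) (hy : y ∈ Cyl v) :
    Rel W (FreeGroup.mk [s]) R (dropLetters t.norm x) (dropLetters t.norm y) ↔
      Rel W v R x y := by
  constructor
  · have key : ∀ z, Rel W (FreeGroup.mk [s]) R (dropLetters t.norm x) z →
        ∃ y ∈ Cyl v, dropLetters t.norm y = z ∧ Rel W v R x y := by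
      intro z h
      induction h with
      | refl => exact ⟨x, hx, rfl, .refl⟩
      | tail _ h ih =>
        obtain ⟨y, hy, rfl, hxy⟩ := ih
        obtain ⟨y', hy', rfl⟩ := exists_dropLetters_eq ht h.2.1
        exact ⟨y', hy', rfl, hxy.tail ((step_dropLetters_iff ht htv hy hy').1 h)⟩
    intro h
    obtain ⟨y', hy', e, h'⟩ := key _ h
    rwa [dropLetters_injOn ht hy' hy e] at h'
  · intro h
    have hh : ∀ y, Rel W v R x y → y ∈ Cyl v ∧
        Rel W (FreeGroup.mk [s]) R (dropLetters t.norm x) (dropLetters t.norm y) := by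
      intro y h
      induction h with
      | refl => exact ⟨hx, .refl⟩
      | tail _ h ih =>
        exact ⟨h.2.1, ih.2.tail ((step_dropLetters_iff ht htv h.1 h.2.1).2 h)⟩
    exact (hh y h).2

theorem dropLetters_mem_crossing {t : FreeGroup (Fin n)} {s : Fin n × Bool}
    (ht : v.toWord = t.toWord ++ [s]) (htv : v = t * FreeGroup.mk [s])
    (hx : x ∈ crossing W v) :
    dropLetters t.norm x ∈ crossing W (FreeGroup.mk [s]) := by
  obtain ⟨hx, u, hu, g, h1, k, hk⟩ := hx
  have e := ray_of_mem_cyl_child ht hx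
  refine ⟨dropLetters_mem_cyl ht htv hx, u, hu, t⁻¹ * g, ?_, k, ?_⟩
  · simpa only [mul_assoc, e] using h1.dropLetters t.norm
  · intro h
    refine hk ?_
    have hd' : ray (dropLetters t.norm x) 1 = FreeGroup.mk [s] := by
      have := dropLetters_mem_cyl ht htv hx
      rwa [mem_cyl, norm_mk_singleton] at this
    have := toWord_mul_of_onGeodesic (m := 0) (g := t⁻¹ * g * FreeGroup.mk u ^ k) e.symm
      (by rw [zero_add, hd']; exact h)
    rw [mul_assoc, mul_inv_cancel_left] at this
    rw [onGeodesic_one_iff, this, ht, List.prefix_append_right_inj]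
    rw [onGeodesic_one_iff, toWord_mk_of_isReduced (by simp), mul_assoc] at h
    exact h

/-- Deleting the word of the parent of `v` carries the half-tree behind `v`, with its lines, to the
half-tree behind the last letter of `v`. This leaves `2n` cases. -/
theorem stable_of_letters (h : ∀ s : Fin n × Bool, ∀ x ∈ crossing W (FreeGroup.mk [s]),
    ∀ y ∈ crossing W (FreeGroup.mk [s]),
      Rel W (FreeGroup.mk [s]) R x y → Rel W (FreeGroup.mk [s]) (R + 1) x y) : Stable W R := by
  intro v hv x hx y hy hxy
  obtain ⟨t, s, ht, htv⟩ := exists_parent hv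
  rw [← rel_dropLetters_iff ht htv hx.1 hy.1] at hxy ⊢
  exact h s _ (dropLetters_mem_crossing ht htv hx) _ (dropLetters_mem_crossing ht htv hy) hxy

/-- The pairs of crossing ends behind the letter `s` that are related at depth `R`. -/
def relPairs (W : List (List (Fin n × Bool))) (R : ℕ) (s : Fin n × Bool) :
    Set (Boundary n × Boundary n) :=
  {p | p ∈ crossing W (FreeGroup.mk [s]) ×ˢ crossing W (FreeGroup.mk [s]) ∧
    Rel W (FreeGroup.mk [s]) R p.1 p.2}

theorem relPairs_finite (s : Fin n × Bool) : (relPairs W R s).Finite :=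
  ((crossing_finite W _).prod (crossing_finite W _)).subset fun _ h => h.1

theorem ncard_relPairs_le (s : Fin n × Bool) :
    (relPairs W R s).ncard ≤ (positions W).length * (positions W).length := by
  refine (Set.ncard_le_ncard (fun _ h => h.1)
    ((crossing_finite W _).prod (crossing_finite W _))).trans ?_
  rw [Set.ncard_prod]
  exact Nat.mul_le_mul (crossing_finite_and_ncard_le W _).2 (crossing_finite_and_ncard_le W _).2

theorem relPairs_succ_subset (s : Fin n × Bool) : relPairs W (R + 1) s ⊆ relPairs W R s :=
  fun _ h => ⟨h.1, h.2.of_le (Nat.le_succ R)⟩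

/-- The finite sets of related pairs decrease with `R`; if none of them shrank, the relations would
be stable for every letter and hence everywhere. -/
theorem sum_ncard_relPairs_lt (h : ¬ Stable W R) :
    ∑ s, (relPairs W (R + 1) s).ncard < ∑ s, (relPairs W R s).ncard := by
  have : ∃ s, relPairs W (R + 1) s ≠ relPairs W R s := by
    by_contra! hc
    refine h (stable_of_letters fun s x hx y hy hxy => ?_)
    have : (x, y) ∈ relPairs W R s := ⟨⟨hx, hy⟩, hxy⟩
    rw [← hc] at this
    exact this.2
  obtain ⟨s, hs⟩ := this
  exact Finset.sum_lt_sum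
    (fun s _ => Set.ncard_le_ncard (relPairs_succ_subset s) (relPairs_finite s))
    ⟨s, Finset.mem_univ s, Set.ncard_lt_ncard
      ((relPairs_succ_subset s).ssubset_of_ne hs) (relPairs_finite s)⟩

/-- A depth at which the relations on the crossing ends are stable. -/
def stableDepth (W : List (List (Fin n × Bool))) : ℕ :=
  n * 2 * ((positions W).length * (positions W).length)

theorem stable_stableDepth (W : List (List (Fin n × Bool))) : Stable W (stableDepth W) := by
  by_contra hc
  have hns : ∀ R ≤ stableDepth W, ¬ Stable W R := fun R hR h => hc (h.of_le hR)
  -- The sum starts at most at `stableDepth W` and each unstable step lowers it by at least one, so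
  -- `stableDepth W + 1` unstable steps are impossible.
  have key : ∀ R ≤ stableDepth W + 1,
      ∑ s, (relPairs W R s).ncard + R ≤ stableDepth W := by
    intro R
    induction R with
    | zero =>
      intro _
      refine (Finset.sum_le_card_nsmul _ _ _ fun s _ => ncard_relPairs_le (R := 0) s).trans ?_
      simp [stableDepth]
    | succ R ih =>
      intro hR
      have h1 := ih (by omega)
      have h2 := sum_ncard_relPairs_lt (hns R (by omega))
      omega
  have := key (stableDepth W + 1) le_rfl
  omega

/-- A function on the half-tree behind `v` can be replaced, without changing it on the lines that
leave the half-tree, by one of bounded depth. -/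
theorem exists_bounded_extension (hv : v ≠ 1) {f : Boundary n → ℤ} {m : ℕ}
    (hdet : ∀ x ∈ Cyl v, ∀ y ∈ Cyl v, ray x m = ray y m → f x = f y)
    (hinv : ∀ x ∈ Cyl v, ∀ y ∈ Cyl v, Partner W x y → f x = f y) :
    ∃ h : Boundary n → ℤ, (∀ x y, Step W v (stableDepth W) x y → h x = h y) ∧
      ∀ x ∈ crossing W v, h x = f x := by
  classical
  have hf : ∀ {x y}, Rel W v m x y → f x = f y := by
    intro x y h
    induction h with
    | refl => rfl
    | tail _ h ih =>
      refine ih.trans (h.2.2.elim (fun e => hdet _ h.1 _ h.2.1 (ray_eq_mono e (by omega)))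
        (hinv _ h.1 _ h.2.1))
  -- By stability, crossing ends related at the stable depth are related at depth `m` too, and `f`
  -- respects that relation.
  have hc : ∀ c ∈ crossing W v, ∀ c' ∈ crossing W v, Rel W v (stableDepth W) c c' → f c = f c' :=
    fun c hc c' hc' h => hf ((stable_stableDepth W).rel_of_rel hv hc hc' h m)
  -- The values of `f` on crossing ends are spread over their classes. A class without crossing ends
  -- is unconstrained, and the value 0 there is arbitrary.
  let h : Boundary n → ℤ := fun x =>
    if H : ∃ c ∈ crossing W v, Rel W v (stableDepth W) x c then f H.choose else 0
  have hval : ∀ {x c}, c ∈ crossing W v → Rel W v (stableDepth W) x c → h x = f c := by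
    intro x c hcc hxc
    have H : ∃ c ∈ crossing W v, Rel W v (stableDepth W) x c := ⟨c, hcc, hxc⟩
    simp only [h, dif_pos H]
    exact hc _ H.choose_spec.1 _ hcc (H.choose_spec.2.symm.trans hxc)
  refine ⟨h, fun x y hxy => ?_, fun x hx => hval hx .refl⟩
  by_cases H : ∃ c ∈ crossing W v, Rel W v (stableDepth W) x c
  · obtain ⟨c, hcc, hxc⟩ := H
    rw [hval hcc hxc, hval hcc (Relation.ReflTransGen.head hxy.symm hxc)]
  · have H' : ¬ ∃ c ∈ crossing W v, Rel W v (stableDepth W) y c := fun ⟨c, hcc, hyc⟩ =>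
      H ⟨c, hcc, Relation.ReflTransGen.head hxy hyc⟩
    simp only [h, dif_neg H, dif_neg H']

end LinePattern

/-! ### Decomposition of a function into pieces of bounded depth. -/

namespace LinePattern

variable {n : ℕ}

/-! ### Cutting functions into pieces of bounded size -/

/-- `f` is constant on lines, vanishes off the half-tree behind `v`, and depends only on the first
`R` letters after `v`. -/
structure IsPiece (W : List (List (Fin n × Bool))) (v : FreeGroup (Fin n)) (R : ℕ)
    (f : Boundary n → ℤ) : Prop where
  inv : ∀ x y, Partner W x y → f x = f y
  zero : ∀ x ∉ Cyl v, f x = 0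
  det : ∀ x y, ray x (v.norm + R) = ray y (v.norm + R) → f x = f y

variable {W : List (List (Fin n × Bool))} {v : FreeGroup (Fin n)} {f : Boundary n → ℤ}

/-- With `h` the bounded extension of `f` behind `c`, take `k = f - h` there and zero elsewhere.
Since `h` and `f` agree on crossing ends, `k` vanishes on every line that leaves the half-tree, so
extending by zero keeps it constant on lines. -/
theorem IsPiece.exists_child {c : FreeGroup (Fin n)} {d : ℕ} (hf : IsPiece W v (d + 1) f)
    (hd : stableDepth W ≤ d) (hc : c.norm = v.norm + 1) :
    ∃ k, IsPiece W c d k ∧ ∀ x ∈ Cyl c, ∀ y ∈ Cyl c,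
      ray x (c.norm + stableDepth W) = ray y (c.norm + stableDepth W) →
        f x - k x = f y - k y := by
  classical
  have hc1 : c ≠ 1 := by rintro rfl; simp at hc
  obtain ⟨h, hstep, hcross⟩ := exists_bounded_extension (W := W) hc1 (f := f)
    (fun x _ y _ e => hf.det x y e) (fun x _ y _ e => hf.inv x y e)
  refine ⟨fun x => if x ∈ Cyl c then f x - h x else 0, ⟨?_, ?_, ?_⟩, ?_⟩
  · intro x y hxy
    by_cases hx : x ∈ Cyl c <;> by_cases hy : y ∈ Cyl c
    · simp only [hx, hy, if_true, hf.inv x y hxy, hstep x y ⟨hx, hy, Or.inr hxy⟩]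
    · simp only [hx, hy, if_true, if_false, hcross x (mem_crossing_of_partner hxy hx hy), sub_self]
    · simp only [hx, hy, if_true, if_false, hcross y (mem_crossing_of_partner hxy.symm hy hx),
        sub_self]
    · simp only [hx, hy, if_false]
  · intro x hx
    simp only [hx, if_false]
  · intro x y e
    have hxy := cyl_congr (v := c) (by omega) e
    by_cases hx : x ∈ Cyl c
    · have hy := hxy.1 hx
      simp only [hx, hy, if_true]
      rw [hf.det x y (by rwa [← add_assoc, add_right_comm, ← hc]),
        hstep x y ⟨hx, hy, Or.inl (ray_eq_mono e (by omega))⟩]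
    · have hy : y ∉ Cyl _ := fun h => hx (hxy.2 h)
      simp only [hx, hy, if_false]
  · intro x hx y hy e
    simp only [hx, hy, if_true, sub_sub_cancel]
    exact hstep x y ⟨hx, hy, Or.inl e⟩

theorem ray_succ_eq_of_letter {x y : Boundary n} (hx : x ∈ Cyl v) (hy : y ∈ Cyl v)
    (h : x.1 v.norm = y.1 v.norm) : ray x (v.norm + 1) = ray y (v.norm + 1) := by
  rw [ray_eq_ray_iff]
  intro i hi
  rcases Nat.lt_succ_iff_lt_or_eq.1 hi with hi | rfl
  · exact ray_eq_ray_iff.1 (Eq.trans (mem_cyl.1 hx) (mem_cyl.1 hy).symm) i hi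
  · exact h

/-- Every piece is a sum of pieces of a bounded depth. -/
theorem IsPiece.mem_closure (d : ℕ) : ∀ {v : FreeGroup (Fin n)} {f : Boundary n → ℤ},
    IsPiece W v d f →
      f ∈ AddSubgroup.closure {f | ∃ v, IsPiece W v (stableDepth W + 1) f} := by
  classical
  induction d with
  | zero =>
    intro v f hf
    exact AddSubgroup.subset_closure
      ⟨v, hf.inv, hf.zero, fun x y e => hf.det x y (ray_eq_mono e (by omega))⟩
  | succ d ih =>
    intro v f hf
    by_cases hd : stableDepth W ≤ d
    swap
    · exact AddSubgroup.subset_closure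
        ⟨v, hf.inv, hf.zero, fun x y e => hf.det x y (ray_eq_mono e (by omega))⟩
    have key : ∀ s : Fin n × Bool, ∃ k : Boundary n → ℤ,
        k ∈ AddSubgroup.closure {f | ∃ v, IsPiece W v (stableDepth W + 1) f} ∧
        (∀ x y, Partner W x y → k x = k y) ∧ (∀ x, ¬ (x ∈ Cyl v ∧ x.1 v.norm = s) → k x = 0) ∧
        ∀ x y, x ∈ Cyl v ∧ x.1 v.norm = s → y ∈ Cyl v ∧ y.1 v.norm = s →
          ray x (v.norm + (stableDepth W + 1)) = ray y (v.norm + (stableDepth W + 1)) →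
            f x - k x = f y - k y := by
      intro s
      by_cases hs : ∃ z, z ∈ Cyl v ∧ z.1 v.norm = s
      · obtain ⟨z, hz, hzs⟩ := hs
        have hmem : ∀ x, x ∈ Cyl (ray z (v.norm + 1)) ↔ x ∈ Cyl v ∧ x.1 v.norm = s := by
          intro x
          rw [mem_cyl_ray]
          constructor
          · intro e
            exact ⟨(cyl_congr (by omega) e).2 hz, (ray_eq_ray_iff.1 e _ (by omega)).trans hzs⟩
          · rintro ⟨hx, hxs⟩
            exact ray_succ_eq_of_letter hx hz (hxs.trans hzs.symm)
        obtain ⟨k, hk, hkd⟩ := hf.exists_child (c := ray z (v.norm + 1)) hd (norm_ray _ _)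
        refine ⟨k, ih hk, hk.inv, fun x hx => hk.zero x fun h => hx ((hmem x).1 h), ?_⟩
        intro x y hx hy e
        refine hkd x ((hmem x).2 hx) y ((hmem y).2 hy) ?_
        rw [norm_ray]
        rwa [show v.norm + 1 + stableDepth W = v.norm + (stableDepth W + 1) by omega]
      -- No boundary point behind `v` continues with `s`, as when `s` cancels the last letter of
      -- `v`; no correction is needed.
      · refine ⟨0, zero_mem _, fun _ _ _ => rfl, fun _ _ => rfl, fun x y hx => ?_⟩
        exact absurd ⟨x, hx⟩ hs
    choose k hkm hki hk0 hkd using key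
    have hsum : ∀ x, x ∈ Cyl v → (∑ s, k s) x = k (x.1 v.norm) x := by
      intro x hx
      rw [Finset.sum_apply]
      exact Finset.sum_eq_single _ (fun s _ hs => hk0 s x fun h => hs h.2.symm)
        (fun h => absurd (Finset.mem_univ _) h)
    have hsum0 : ∀ x, x ∉ Cyl v → (∑ s, k s) x = 0 := by
      intro x hx
      rw [Finset.sum_apply]
      exact Finset.sum_eq_zero fun s _ => hk0 s x fun h => hx h.1
    -- The remainder has depth `stableDepth W + 1` at `v`: one letter selects the child, and
    -- `stableDepth W` further letters determine the value behind it.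
    rw [← sub_add_cancel f (∑ s, k s)]
    refine add_mem (AddSubgroup.subset_closure ⟨v, ?_, ?_, ?_⟩) (sum_mem fun s _ => hkm s)
    · intro x y hxy
      rw [Pi.sub_apply, Pi.sub_apply, Finset.sum_apply, Finset.sum_apply, hf.inv x y hxy,
        Finset.sum_congr rfl fun s _ => hki s x y hxy]
    · intro x hx
      rw [Pi.sub_apply, hsum0 x hx, hf.zero x hx, sub_self]
    · intro x y e
      have hxy := cyl_congr (v := v) (by omega) e
      by_cases hx : x ∈ Cyl v
      · have hy := hxy.1 hx
        have hl : x.1 v.norm = y.1 v.norm := ray_eq_ray_iff.1 e _ (by omega)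
        rw [Pi.sub_apply, Pi.sub_apply, hsum x hx, hsum y hy, ← hl]
        exact hkd _ x y ⟨hx, rfl⟩ ⟨hy, hl.symm⟩ e
      · have hy : y ∉ Cyl _ := fun h => hx (hxy.2 h)
        rw [Pi.sub_apply, Pi.sub_apply, hsum0 x hx, hsum0 y hy, hf.zero x hx, hf.zero y hy]

end LinePattern

/-! ### Balls, their sizes and the shadows seen from them. -/

namespace LinePattern

variable {n : ℕ}

/-! ### Balls in the Cayley tree -/

/-- The ball of radius `R` about the identity. -/
def ball (n : ℕ) : ℕ → Finset (FreeGroup (Fin n))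
  | 0 => {1}
  | R + 1 => ball n R ∪ (ball n R ×ˢ (Finset.univ : Finset (Fin n × Bool))).image
      fun p => p.1 * FreeGroup.mk [p.2]

theorem mem_ball {R : ℕ} {g : FreeGroup (Fin n)} : g ∈ ball n R ↔ g.norm ≤ R := by
  induction R generalizing g with
  | zero => simp [ball]
  | succ R ih =>
    simp only [ball, Finset.mem_union, Finset.mem_image, Finset.mem_product, Finset.mem_univ,
      and_true, ih]
    constructor
    · rintro (h | ⟨⟨t, s⟩, ht, rfl⟩)
      · omega
      · have := FreeGroup.norm_mul_le t (FreeGroup.mk [s])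
        rw [norm_mk_singleton] at this
        change t.norm ≤ R at ht
        change (t * FreeGroup.mk [s]).norm ≤ R + 1
        omega
    · intro h
      by_cases hg : g = 1
      · left; simp [hg]
      · obtain ⟨t, s, ht, e⟩ := exists_parent hg
        have := norm_parent ht
        exact Or.inr ⟨(t, s), by simp only; omega, e.symm⟩

theorem card_ball_le (n R : ℕ) : (ball n R).card ≤ (2 * n + 1) ^ R := by
  induction R with
  | zero => simp [ball]
  | succ R ih =>
    calc (ball n (R + 1)).card ≤ (ball n R).card + (ball n R).card * (n * 2) := by
          refine (Finset.card_union_le _ _).trans (Nat.add_le_add_left ?_ _)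
          refine Finset.card_image_le.trans ?_
          simp
      _ = (ball n R).card * (2 * n + 1) := by ring
      _ ≤ _ := by rw [pow_succ]; exact Nat.mul_le_mul_right _ ih

/-- The ball of radius `R` about `v`. -/
def ballAt (v : FreeGroup (Fin n)) (R : ℕ) : Finset (FreeGroup (Fin n)) :=
  (ball n R).image (v * ·)

theorem mem_ballAt {v g : FreeGroup (Fin n)} {R : ℕ} :
    g ∈ ballAt v R ↔ (v⁻¹ * g).norm ≤ R := by
  simp only [ballAt, Finset.mem_image, mem_ball]
  constructor
  · rintro ⟨a, ha, rfl⟩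
    rwa [inv_mul_cancel_left]
  · intro h
    exact ⟨_, h, mul_inv_cancel_left _ _⟩

theorem self_mem_ballAt (v : FreeGroup (Fin n)) (R : ℕ) : v ∈ ballAt v R := by
  simp [mem_ballAt]

theorem card_ballAt_le (v : FreeGroup (Fin n)) (R : ℕ) : (ballAt v R).card ≤ (2 * n + 1) ^ R :=
  Finset.card_image_le.trans (card_ball_le n R)

theorem adj_mul_letter (x : FreeGroup (Fin n)) (s : Fin n × Bool) :
    (cayleyTree n).Adj x (x * FreeGroup.mk [s]) := by
  rw [cayleyTree, SimpleGraph.mulCayley_adj']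
  refine ⟨fun h => ?_, ?_⟩
  · have h1 : FreeGroup.mk [s] = 1 := by simpa using h.symm
    have := norm_mk_singleton s
    simp [h1] at this
  · obtain ⟨i, _ | _⟩ := s
    · refine ⟨FreeGroup.of i, ⟨i, rfl⟩, Or.inr ?_⟩
      have : FreeGroup.mk [(i, false)] = (FreeGroup.of i)⁻¹ := rfl
      rw [this, inv_mul_cancel_right]
    · exact ⟨FreeGroup.of i, ⟨i, rfl⟩, Or.inl rfl⟩

theorem norm_le_of_adj {v x a : FreeGroup (Fin n)} (h : (cayleyTree n).Adj x a) :
    (v⁻¹ * a).norm ≤ (v⁻¹ * x).norm + 1 := by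
  rw [cayleyTree, SimpleGraph.mulCayley_adj'] at h
  obtain ⟨-, _, ⟨i, rfl⟩, rfl | rfl⟩ := h
  · have := FreeGroup.norm_mul_le (v⁻¹ * x) (FreeGroup.of i)
    rwa [FreeGroup.norm_of, mul_assoc] at this
  · have := FreeGroup.norm_mul_le (v⁻¹ * (a * FreeGroup.of i)) (FreeGroup.of i)⁻¹
    rw [FreeGroup.norm_inv_eq, FreeGroup.norm_of] at this
    convert this using 2
    group

theorem isSubtree_ballAt (v : FreeGroup (Fin n)) (R : ℕ) : IsSubtree (ballAt v R) := by
  have key : ∀ k, ∀ x (hx : x ∈ (ballAt v R : Set (FreeGroup (Fin n)))), (v⁻¹ * x).norm = k →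
      ((cayleyTree n).induce (ballAt v R : Set (FreeGroup (Fin n)))).Reachable
        ⟨v, self_mem_ballAt v R⟩ ⟨x, hx⟩ := by
    intro k
    induction k with
    | zero =>
      intro x hx h
      obtain rfl : v = x := by
        rw [FreeGroup.norm_eq_zero, inv_mul_eq_one] at h
        exact h
      exact .refl _
    | succ k ih =>
      intro x hx h
      obtain ⟨t, s, ht, e⟩ := exists_parent (v := v⁻¹ * x) (by intro h1; simp [h1] at h)
      have hn := norm_parent ht
      have hx' : (v⁻¹ * x).norm ≤ R := mem_ballAt.1 hx
      have hvt : v * t ∈ (ballAt v R : Set (FreeGroup (Fin n))) :=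
        mem_ballAt.2 (by rw [inv_mul_cancel_left]; omega)
      refine (ih (v * t) hvt (by rw [inv_mul_cancel_left]; omega)).trans
        (SimpleGraph.Adj.reachable ?_)
      have hxe : x = v * t * FreeGroup.mk [s] := by
        rw [mul_assoc, ← e, mul_inv_cancel_left]
      rw [SimpleGraph.comap_adj]
      change (cayleyTree n).Adj (v * t) x
      rw [hxe]
      exact adj_mul_letter _ _
  intro x y
  exact (key _ x.1 x.2 rfl).symm.trans (key _ y.1 y.2 rfl)

/-! ### Shadows as seen from a ball -/

theorem ray_succ (ξ : Boundary n) (m : ℕ) :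
    ray ξ (m + 1) = ray ξ m * FreeGroup.mk [ξ.1 m] := by
  simp [ray, List.range_succ, FreeGroup.mul_mk]

/-- A ray from the identity moves away from `v` after its first `|v|` steps. -/
theorem toWord_inv_mul_ray_succ {v : FreeGroup (Fin n)} (ξ : Boundary n) {m : ℕ}
    (hm : v.norm ≤ m) :
    (v⁻¹ * ray ξ (m + 1)).toWord = (v⁻¹ * ray ξ m).toWord ++ [ξ.1 m] := by
  have hr : v⁻¹ * ray ξ (m + 1) = v⁻¹ * ray ξ m * FreeGroup.mk [ξ.1 m] := by
    rw [ray_succ, mul_assoc]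
  rcases toWord_mul_letter (v⁻¹ * ray ξ m) (ξ.1 m) with h | h
  · rw [hr, h]
  -- Otherwise the geodesic from `ray ξ m` to `v` begins with the next letter of the ray. It then
  -- continues the ray without cancellation, giving `v.norm ≥ m + 1`.
  · exfalso
    have h1 : ((ray ξ m)⁻¹ * v).toWord =
        [ξ.1 m] ++ FreeGroup.invRev (v⁻¹ * ray ξ (m + 1)).toWord := by
      have : (ray ξ m)⁻¹ * v = (v⁻¹ * ray ξ m)⁻¹ := by group
      rw [this, FreeGroup.toWord_inv, h, ← hr]
      simp [FreeGroup.invRev]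
    have h2 : (ray ξ m * ((ray ξ m)⁻¹ * v)).toWord =
        (ray ξ m).toWord ++ ((ray ξ m)⁻¹ * v).toWord := by
      apply toWord_mul_of_isReduced
      have h3 : (ray ξ (m + 1)).toWord = (ray ξ m).toWord ++ [ξ.1 m] := by
        simp [toWord_ray, List.range_succ]
      rw [h1, ← List.append_assoc]
      refine FreeGroup.IsReduced.append_overlap ?_ ?_ (by simp)
      · rw [← h3]; exact FreeGroup.isReduced_toWord
      · rw [← h1]; exact FreeGroup.isReduced_toWord
    rw [mul_inv_cancel_left, h1, toWord_ray] at h2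
    have h4 := congrArg List.length h2
    have h5 : v.toWord.length = v.norm := rfl
    simp only [List.length_append, List.length_map, List.length_range, List.length_singleton] at h4
    omega

theorem onGeodesic_inv_mul_ray {v : FreeGroup (Fin n)} (ξ : Boundary n) {m m' : ℕ}
    (hm : v.norm ≤ m) (hm' : m ≤ m') :
    OnGeodesic 1 (v⁻¹ * ray ξ m) (v⁻¹ * ray ξ m') := by
  rw [onGeodesic_one_iff]
  induction m', hm' using Nat.le_induction with
  | base => exact List.prefix_rfl
  | succ k hk ih =>
    rw [toWord_inv_mul_ray_succ ξ (hm.trans hk)]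
    exact ih.trans (List.prefix_append _ _)

theorem le_norm_inv_mul_ray {v : FreeGroup (Fin n)} (ξ : Boundary n) (k : ℕ) :
    k ≤ (v⁻¹ * ray ξ (v.norm + k)).norm := by
  induction k with
  | zero => omega
  | succ k ih =>
    have := congrArg List.length (toWord_inv_mul_ray_succ (v := v) ξ (Nat.le_add_right v.norm k))
    rw [List.length_append, List.length_singleton] at this
    change (v⁻¹ * ray ξ (v.norm + (k + 1))).norm = (v⁻¹ * ray ξ (v.norm + k)).norm + 1 at this
    omega

/-- Past `v.norm` steps the ray moves away from `v`, so the geodesics from `v` to its vertices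
extend one another; the one to step `v.norm + k` has length at least `k` and already decides whether
`a` lies on it. -/
theorem mem_shadow_iff {v a : FreeGroup (Fin n)} {k : ℕ} (hk : (v⁻¹ * a).norm ≤ k)
    {ξ : Boundary n} :
    ξ ∈ shadow v a ↔ OnGeodesic 1 (v⁻¹ * a) (v⁻¹ * ray ξ (v.norm + k)) := by
  have hs : ξ ∈ shadow v a ↔ ∀ᶠ m in atTop, OnGeodesic 1 (v⁻¹ * a) (v⁻¹ * ray ξ m) := by
    simp only [shadow, mem_ofPred_eq, onGeodesic_iff, inv_one, one_mul]
  rw [hs]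
  constructor
  · intro h
    obtain ⟨m, hm, hm'⟩ := (h.and (eventually_ge_atTop (v.norm + k))).exists
    exact onGeodesic_of_norm_le hm (onGeodesic_inv_mul_ray ξ (by omega) hm')
      (hk.trans (le_norm_inv_mul_ray ξ k))
  · intro h
    filter_upwards [eventually_ge_atTop (v.norm + k)] with m hm
    exact onGeodesic_one_trans h (onGeodesic_inv_mul_ray ξ (by omega) hm)

theorem norm_letter_mul (s c : Fin n × Bool) {w : FreeGroup (Fin n)} {L : List (Fin n × Bool)}
    (h : w.toWord = c :: L) :
    (FreeGroup.mk [s] * w).norm + (if s.1 = c.1 ∧ s.2 = !c.2 then 2 else 0) = w.norm + 1 := by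
  unfold FreeGroup.norm
  have hr : FreeGroup.reduce (c :: L) = c :: L := by rw [← h, FreeGroup.reduce_toWord]
  rw [FreeGroup.toWord_mul, toWord_mk_of_isReduced (by simp), h, List.singleton_append,
    FreeGroup.reduce.cons, hr]
  simp only
  split_ifs <;> simp

theorem inv_mk_singleton (s : Fin n × Bool) : (FreeGroup.mk [s])⁻¹ =
    FreeGroup.mk [((s.1, !s.2) : Fin n × Bool)] := by
  rw [FreeGroup.inv_mk]; rfl

/-- A geodesic from the identity through `b` can be started at any point that is nearer to the
identity than `b`. -/
theorem OnGeodesic.of_norm_lt {b r : FreeGroup (Fin n)} (h : OnGeodesic 1 b r)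
    (g : FreeGroup (Fin n)) (hg : g.norm < b.norm) : OnGeodesic g b r := by
  obtain ⟨k, hk⟩ : ∃ k, g.norm = k := ⟨_, rfl⟩
  induction k generalizing g with
  | zero => rwa [FreeGroup.norm_eq_zero.1 hk]
  | succ k ih =>
    obtain ⟨t, s, ht, e⟩ := exists_parent (v := g) (by rintro rfl; simp at hk)
    have hn := norm_parent ht
    have iht := ih t (by omega) (by omega)
    have htb : t⁻¹ * b ≠ 1 := by
      intro h1
      rw [inv_mul_eq_one] at h1
      rw [h1] at hn
      omega
    obtain ⟨c, L, hc⟩ : ∃ c L, (t⁻¹ * b).toWord = c :: L := by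
      cases hw : (t⁻¹ * b).toWord with
      | nil => exact absurd (FreeGroup.toWord_eq_nil_iff.1 hw) htb
      | cons c L => exact ⟨c, L, rfl⟩
    obtain ⟨q, hq⟩ := onGeodesic_iff.1 iht
    -- The word of `t⁻¹ * b` is a nonempty prefix of that of `t⁻¹ * r`. Both begin with `c`, so
    -- moving the base point from `t` to `g` changes both lengths by the same amount.
    have h1 := norm_letter_mul (s.1, !s.2) c hc
    have h2 := norm_letter_mul (s.1, !s.2) c (w := t⁻¹ * r) (L := L ++ q) (by rw [← hq, hc]; rfl)
    unfold OnGeodesic at iht ⊢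
    rw [e, mul_inv_rev, inv_mk_singleton, mul_assoc, mul_assoc]
    omega

theorem norm_whVertex {v : FreeGroup (Fin n)} {R : ℕ} (a : WhVertex (ballAt v R)) :
    (v⁻¹ * a.1).norm = R + 1 := by
  obtain ⟨a, ha, x, hx, hxa⟩ := a
  rw [mem_ballAt] at ha hx
  have := norm_le_of_adj (v := v) hxa
  simp only
  omega

/-- The centre alone decides membership: every point of the ball is nearer to `v` than `a` is, so
`OnGeodesic.of_norm_lt` moves the base point from `v` to any of them. -/
theorem mem_shadowFrom_ballAt {v : FreeGroup (Fin n)} {R : ℕ} {a : WhVertex (ballAt v R)}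
    {ξ : Boundary n} : ξ ∈ shadowFrom (ballAt v R) a ↔
      OnGeodesic 1 (v⁻¹ * a.1) (v⁻¹ * ray ξ (v.norm + (R + 1))) := by
  rw [← mem_shadow_iff (norm_whVertex a).le]
  constructor
  · intro h
    exact h v (self_mem_ballAt v R)
  · intro h x hx
    filter_upwards [h] with m hm
    rw [mem_ballAt] at hx
    have h1 : OnGeodesic 1 (v⁻¹ * a.1) (v⁻¹ * ray ξ m) := by
      rw [onGeodesic_iff] at hm
      rwa [onGeodesic_one_iff]
    have h2 := h1.of_norm_lt (v⁻¹ * x) (by rw [norm_whVertex]; omega)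
    rw [onGeodesic_iff] at h2 ⊢
    simpa [mul_assoc] using h2

theorem shadowFrom_disjoint {v : FreeGroup (Fin n)} {R : ℕ} {a b : WhVertex (ballAt v R)}
    {ξ : Boundary n} (ha : ξ ∈ shadowFrom _ a) (hb : ξ ∈ shadowFrom _ b) : a = b := by
  rw [mem_shadowFrom_ballAt] at ha hb
  have := eq_of_onGeodesic_of_norm ha hb (by rw [norm_whVertex, norm_whVertex])
  exact Subtype.ext (mul_left_cancel this)

theorem exists_mem_shadowFrom (v : FreeGroup (Fin n)) (R : ℕ) (ξ : Boundary n) :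
    ∃ a : WhVertex (ballAt v R), ξ ∈ shadowFrom _ a := by
  let y := v⁻¹ * ray ξ (v.norm + (R + 1))
  have hy : R + 1 ≤ y.norm := le_norm_inv_mul_ray ξ (R + 1)
  let b := FreeGroup.mk (y.toWord.take (R + 1))
  have hb : b.toWord = y.toWord.take (R + 1) := toWord_mk_of_isReduced
    (FreeGroup.isReduced_toWord.infix (List.take_prefix _ _).isInfix)
  have hbn : b.norm = R + 1 := by
    unfold FreeGroup.norm at hy ⊢
    rw [hb, List.length_take]
    omega
  have hby : OnGeodesic 1 b y := by
    rw [onGeodesic_one_iff, hb]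
    exact List.take_prefix _ _
  obtain ⟨t, s, ht, e⟩ := exists_parent (v := b) (by intro h; simp [h] at hbn)
  have htn := norm_parent ht
  have hva : v * b ∉ ballAt v R := by
    rw [mem_ballAt, inv_mul_cancel_left]; omega
  have hvt : v * t ∈ ballAt v R := by
    rw [mem_ballAt, inv_mul_cancel_left]; omega
  have hadj : (cayleyTree n).Adj (v * t) (v * b) := by
    rw [e, ← mul_assoc]
    exact adj_mul_letter _ _
  let a : WhVertex (ballAt v R) := ⟨v * b, hva, v * t, hvt, hadj⟩
  refine ⟨a, mem_shadowFrom_ballAt.2 ?_⟩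
  rw [show v⁻¹ * a.1 = b from inv_mul_cancel_left _ _]
  exact hby

theorem shadowFrom_congr {v : FreeGroup (Fin n)} {R : ℕ} {a : WhVertex (ballAt v R)}
    {x y : Boundary n} (h : ray x (v.norm + (R + 1)) = ray y (v.norm + (R + 1))) :
    x ∈ shadowFrom _ a ↔ y ∈ shadowFrom _ a := by
  rw [mem_shadowFrom_ballAt, mem_shadowFrom_ballAt, h]

/-- A piece is constant on the shadows as seen from a ball. -/
theorem IsPiece.eq_of_mem_shadowFrom {W : List (List (Fin n × Bool))} {v : FreeGroup (Fin n)}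
    {R : ℕ} {f : Boundary n → ℤ} (hf : IsPiece W v R f) {a : WhVertex (ballAt v R)}
    {x y : Boundary n} (hx : x ∈ shadowFrom _ a) (hy : y ∈ shadowFrom _ a) : f x = f y := by
  rw [mem_shadowFrom_ballAt] at hx hy
  have key : ∀ {x : Boundary n}, x ∈ Cyl v →
      OnGeodesic 1 (v⁻¹ * a.1) (v⁻¹ * ray x (v.norm + (R + 1))) →
        ray x (v.norm + (R + 1)) = a.1 := by
    intro x hxv hx
    have h1 := (mem_cyl_iff (Nat.le_add_right v.norm (R + 1))).1 hxv
    have h2 : v.norm + (v⁻¹ * ray x (v.norm + (R + 1))).norm = v.norm + (R + 1) := by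
      simpa [OnGeodesic] using h1
    refine (mul_left_cancel (eq_of_onGeodesic_of_norm hx (onGeodesic_one_self _) ?_)).symm
    rw [norm_whVertex]
    omega
  have key' : ∀ {x y : Boundary n}, x ∈ Cyl v → y ∉ Cyl v →
      OnGeodesic 1 (v⁻¹ * a.1) (v⁻¹ * ray x (v.norm + (R + 1))) →
      ¬ OnGeodesic 1 (v⁻¹ * a.1) (v⁻¹ * ray y (v.norm + (R + 1))) := by
    intro x y hxv hyv hx hy
    have h1 := toWord_eq_append ((mem_cyl_iff (Nat.le_add_right v.norm (R + 1))).1 hxv)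
    rw [key hxv hx] at h1
    obtain ⟨q, hq⟩ := onGeodesic_one_iff.1 hy
    have h2 : (v * (v⁻¹ * ray y (v.norm + (R + 1)))).toWord =
        v.toWord ++ (v⁻¹ * ray y (v.norm + (R + 1))).toWord := by
      apply toWord_mul_of_isReduced
      rw [← hq, ← List.append_assoc]
      refine FreeGroup.IsReduced.append_overlap (h1 ▸ FreeGroup.isReduced_toWord)
        (hq ▸ FreeGroup.isReduced_toWord) fun h0 => ?_
      have h3 := norm_whVertex a
      rw [FreeGroup.norm, h0] at h3
      simp at h3
    rw [mul_inv_cancel_left] at h2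
    exact hyv ((mem_cyl_iff (Nat.le_add_right v.norm (R + 1))).2
      (onGeodesic_one_iff.2 ⟨_, h2.symm⟩))
  -- A shadow either lies behind `v`, where its points share `v.norm + R + 1` letters, or misses the
  -- half-tree behind `v`, where `f` is zero.
  by_cases hxv : x ∈ Cyl v <;> by_cases hyv : y ∈ Cyl v
  · refine hf.det x y (ray_eq_mono (m := v.norm + (R + 1)) ?_ (by omega))
    rw [key hxv hx, key hyv hy]
  · exact absurd hy (key' hxv hyv hx)
  · exact absurd hx (key' hyv hxv hy)
  · rw [hf.zero x hxv, hf.zero y hyv]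

end LinePattern

/-! ### Topology of the decomposition space and existence of associated covers. -/

namespace LinePattern

variable {n : ℕ}

/-! ### The decomposition space -/

/-- By `partner_unique`, equality together with `Partner` is already transitive, so generating an
equivalence relation adds nothing: fibres have at most two points. -/
theorem mk_eq_mk_iff {W : List (List (Fin n × Bool))} {x y : Boundary n} :
    Quot.mk (IsLine (elements W)) x = Quot.mk _ y ↔ x = y ∨ Partner W x y := by
  constructor
  · intro h
    have h' := Quot.eqvGen_exact h
    clear h
    induction h' with
    | rel x y h => exact Or.inr (partner_iff.2 (Or.inl h))
    | refl x => exact Or.inl rfl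
    | symm x y _ ih => exact ih.imp Eq.symm Partner.symm
    | trans x y z _ _ ih1 ih2 =>
      rcases ih1 with rfl | h1
      · exact ih2
      · rcases ih2 with rfl | h2
        · exact Or.inr h1
        · exact Or.inl (partner_unique h1.symm h2)
  · rintro (rfl | h)
    · rfl
    · rcases partner_iff.1 h with h | h
      · exact Quot.sound h
      · exact (Quot.sound h).symm

theorem whiteheadGraph_adj_iff {W : List (List (Fin n × Bool))} {X : Finset (FreeGroup (Fin n))}
    {a b : WhVertex X} : (whiteheadGraph (elements W) X).Adj a b ↔
      a ≠ b ∧ ∃ ξ ∈ shadowFrom X a, ∃ η ∈ shadowFrom X b, Partner W ξ η := by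
  rw [whiteheadGraph, SimpleGraph.fromRel_adj]
  refine and_congr_right fun _ => ⟨?_, ?_⟩
  · rintro (⟨ξ, hξ, η, hη, h⟩ | ⟨ξ, hξ, η, hη, h⟩)
    · exact ⟨ξ, hξ, η, hη, partner_iff.2 (Or.inl h)⟩
    · exact ⟨η, hη, ξ, hξ, partner_iff.2 (Or.inr h)⟩
  · rintro ⟨ξ, hξ, η, hη, h⟩
    rcases partner_iff.1 h with h | h
    · exact Or.inl ⟨ξ, hξ, η, hη, h⟩
    · exact Or.inr ⟨η, hη, ξ, hξ, h⟩

theorem isOpen_of_ray_congr {T : Set (Boundary n)} {m : ℕ}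
    (h : ∀ x y, ray x m = ray y m → x ∈ T → y ∈ T) : IsOpen T := by
  rw [isOpen_iff_mem_nhds]
  intro x hx
  have hU : IsOpen {y : Boundary n | ∀ i ∈ Finset.range m, y.1 i = x.1 i} := by
    simp only [ofPred_forall]
    refine isOpen_biInter_finset fun i _ => ?_
    have hc : Continuous fun y : Boundary n => y.1 i :=
      (continuous_apply i).comp continuous_subtype_val
    exact (isOpen_discrete ({x.1 i} : Set (Fin n × Bool))).preimage hc
  refine mem_of_superset (hU.mem_nhds fun _ _ => rfl) fun y hy => h x y ?_ hx
  exact ray_eq_ray_iff.2 fun i hi => (hy i (Finset.mem_range.2 hi)).symm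

/-- The points of the decomposition space all of whose representatives lie in a set that depends
only on finitely many letters form an open set. -/
theorem isOpen_saturated {W : List (List (Fin n × Bool))} {T : Set (Boundary n)} {m : ℕ}
    (h : ∀ x y, ray x m = ray y m → x ∈ T → y ∈ T) :
    IsOpen {d : DecompositionSpace (elements W) | ∀ x, Quot.mk _ x = d → x ∈ T} := by
  rw [isOpen_coinduced]
  have e : (Quot.mk (IsLine (elements W))) ⁻¹'
      {d : DecompositionSpace (elements W) | ∀ x, Quot.mk _ x = d → x ∈ T} =
      T ∩ {x | x ∈ T ∧ ∃ y, Partner W x y ∧ y ∉ T}ᶜ := by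
    ext x
    simp only [mem_preimage, mem_ofPred_eq, mem_inter_iff, mem_compl_iff, not_and, not_exists,
      not_not]
    constructor
    · intro hx
      exact ⟨hx x rfl, fun _ y hy => hx y (mk_eq_mk_iff.2 (Or.inr hy.symm))⟩
    · rintro ⟨hx, hy⟩ z hz
      rcases mk_eq_mk_iff.1 hz with rfl | hz
      · exact hx
      · exact hy hx z hz.symm
  rw [e]
  -- A line with one end in `T` and one outside has ends differing among the first `m` letters, so
  -- only finitely many points are removed.
  refine (isOpen_of_ray_congr h).inter (Set.Finite.isClosed ?_).isOpen_compl
  refine (finite_partner_ray_ne W m).subset ?_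
  rintro x ⟨hx, y, hxy, hy⟩
  exact ⟨y, hxy, fun e => hy (h x y e hx)⟩

theorem exists_separating_depth {E : Set (Boundary n)} (hE : E.Finite) (M : ℕ) :
    ∃ m, M ≤ m ∧ ∀ x ∈ E, ∀ y ∈ E, ray x m = ray y m → x = y := by
  have h1 : ∀ p : Boundary n × Boundary n, ∃ m, ray p.1 m = ray p.2 m → p.1 = p.2 := by
    intro p
    by_contra! hc
    exact (hc 0).2 (boundary_ext fun m => (hc m).1)
  choose m hm using h1
  obtain ⟨B, hB⟩ := ((hE.prod hE).image m).bddAbove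
  refine ⟨max M B, le_max_left _ _, fun x hx y hy e => hm (x, y) (ray_eq_mono e ?_)⟩
  exact (hB ⟨(x, y), ⟨hx, hy⟩, rfl⟩).trans (le_max_right _ _)

/-- Covers associated to balls exist. -/
theorem exists_associatedFamily (W : List (List (Fin n × Bool))) (v : FreeGroup (Fin n)) (R : ℕ) :
    ∃ U, IsAssociatedFamily (elements W) (ballAt v R) U := by
  let S : WhVertex (ballAt v R) → Set (Boundary n) := shadowFrom (ballAt v R)
  let E : Set (Boundary n) := {x | ∃ y, Partner W x y ∧
    ray x (v.norm + (R + 1)) ≠ ray y (v.norm + (R + 1))}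
  obtain ⟨m, hMm, hm⟩ := exists_separating_depth
    (finite_partner_ray_ne W (v.norm + (R + 1))) (v.norm + (R + 1))
  have hScongr : ∀ {a x y}, ray x m = ray y m → (x ∈ S a ↔ y ∈ S a) := fun {a x y} e =>
    shadowFrom_congr (ray_eq_mono e hMm)
  have hdisj : ∀ {a b x}, x ∈ S a → x ∈ S b → a = b := shadowFrom_disjoint
  have hE : ∀ {a x y}, Partner W x y → x ∉ S a → y ∈ S a → x ∈ E := fun {a x y} h hx hy =>
    ⟨y, h, fun e => hx ((shadowFrom_congr e).2 hy)⟩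
  -- The shadow is enlarged by a cylinder of depth `m` around the outer end of each line leaving it.
  -- The depth `m` separates all such ends, so each added cylinder belongs to one line only.
  let T : WhVertex (ballAt v R) → Set (Boundary n) := fun a =>
    {x | x ∈ S a ∨ ∃ ξ, ξ ∉ S a ∧ (∃ η ∈ S a, Partner W ξ η) ∧ ray x m = ray ξ m}
  have hST : ∀ {a x y}, x ∈ S a → (x = y ∨ Partner W x y) → y ∈ T a := by
    rintro a x y hx (rfl | h)
    · exact Or.inl hx
    · by_cases hy : y ∈ S a
      · exact Or.inl hy
      · exact Or.inr ⟨y, hy, ⟨x, hx, h.symm⟩, rfl⟩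
  -- A point of two of the sets `T` that is in neither of the shadows does not exist.
  have htwo : ∀ {a b x}, a ≠ b → x ∈ T a → x ∈ T b → x ∈ S a ∨ x ∈ S b := by
    intro a b x hab ha hb
    by_contra! hc
    obtain ⟨ξ, hξ, ⟨η, hη, h⟩, e⟩ := ha.resolve_left hc.1
    obtain ⟨ξ', hξ', ⟨η', hη', h'⟩, e'⟩ := hb.resolve_left hc.2
    obtain rfl : ξ = ξ' := hm _ (hE h hξ hη) _ (hE h' hξ' hη') (e.symm.trans e')
    obtain rfl := partner_unique h h'
    exact hab (hdisj hη hη')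
  have hadj : ∀ {a b x}, a ≠ b → x ∈ S a → x ∈ T b →
      ∃ ξ ∈ S a, ∃ η ∈ S b, Partner W ξ η := by
    intro a b x hab ha hb
    obtain ⟨ξ, hξ, ⟨η, hη, h⟩, e⟩ := hb.resolve_left fun hb => hab (hdisj ha hb)
    exact ⟨ξ, (hScongr e).1 ha, η, hη, h⟩
  refine ⟨fun a => {d | ∀ x, Quot.mk _ x = d → x ∈ T a}, ?_, ?_, ?_, ?_, ?_⟩
  · intro a
    refine isOpen_saturated (m := m) fun x y e hx => ?_
    exact hx.imp (hScongr e).1 fun ⟨ξ, h1, h2, h3⟩ => ⟨ξ, h1, h2, e.symm.trans h3⟩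
  · refine eq_univ_of_forall fun d => ?_
    induction d using Quot.ind with
    | mk x =>
      obtain ⟨a, ha⟩ := exists_mem_shadowFrom v R x
      exact mem_iUnion.2 ⟨a, fun y hy => hST ha (mk_eq_mk_iff.1 hy.symm)⟩
  · rintro a _ ⟨x, hx, rfl⟩ y hy
    exact hST hx (mk_eq_mk_iff.1 hy.symm)
  · intro a b hab
    rw [whiteheadGraph_adj_iff]
    constructor
    · rintro ⟨d, ha, hb⟩
      induction d using Quot.ind with
      | mk x =>
        refine ⟨hab, ?_⟩
        rcases htwo hab (ha x rfl) (hb x rfl) with h | h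
        · exact hadj hab h (hb x rfl)
        · obtain ⟨ξ, hξ, η, hη, h⟩ := hadj hab.symm h (ha x rfl)
          exact ⟨η, hη, ξ, hξ, h.symm⟩
    · rintro ⟨-, ξ, hξ, η, hη, h⟩
      refine ⟨Quot.mk _ ξ, fun y hy => hST hξ (mk_eq_mk_iff.1 hy.symm), fun y hy => ?_⟩
      rw [mk_eq_mk_iff.2 (Or.inr h)] at hy
      exact hST hη (mk_eq_mk_iff.1 hy.symm)
  · intro a b c hab hac hbc
    refine eq_empty_of_forall_notMem ?_
    rintro d ⟨⟨ha, hb⟩, hc⟩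
    induction d using Quot.ind with
    | mk x =>
      have ha := ha x rfl
      have hb := hb x rfl
      have hc := hc x rfl
      rcases htwo hab ha hb with h | h
      · rcases htwo hbc hb hc with h' | h'
        · exact hab (hdisj h h')
        · exact hac (hdisj h h')
      · rcases htwo hac ha hc with h' | h'
        · exact hab (hdisj h' h)
        · exact hbc (hdisj h h')

end LinePattern

/-! ### Classes in degree zero as functions on the space. -/

namespace OpenCover

variable {X : Type} [TopologicalSpace X]

/-- The common refinement of two covers. -/
def inf (𝒰 𝒱 : OpenCover X) : OpenCover X where
  sets := {w | ∃ u ∈ 𝒰.sets, ∃ v ∈ 𝒱.sets, u ∩ v = w}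
  isOpen := by
    rintro _ ⟨u, hu, v, hv, rfl⟩
    exact (𝒰.isOpen u hu).inter (𝒱.isOpen v hv)
  covers := by
    refine eq_univ_of_forall fun x => ?_
    obtain ⟨u, hu, hxu⟩ := mem_sUnion.1 (𝒰.covers ▸ mem_univ x)
    obtain ⟨v, hv, hxv⟩ := mem_sUnion.1 (𝒱.covers ▸ mem_univ x)
    exact ⟨u ∩ v, ⟨u, hu, v, hv, rfl⟩, hxu, hxv⟩

theorem le_inf_left (𝒰 𝒱 : OpenCover X) : 𝒰 ≤ inf 𝒰 𝒱 := by
  rintro _ ⟨u, hu, v, hv, rfl⟩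
  exact ⟨u, hu, inter_subset_left⟩

theorem le_inf_right (𝒰 𝒱 : OpenCover X) : 𝒱 ≤ inf 𝒰 𝒱 := by
  rintro _ ⟨u, hu, v, hv, rfl⟩
  exact ⟨v, hv, inter_subset_right⟩

instance : IsDirectedOrder (OpenCover X) :=
  ⟨fun 𝒰 𝒱 => ⟨inf 𝒰 𝒱, le_inf_left 𝒰 𝒱, le_inf_right 𝒰 𝒱⟩⟩

instance : Nonempty (OpenCover X) :=
  ⟨⟨{univ}, by rintro _ rfl; exact isOpen_univ, sUnion_singleton _⟩⟩

end OpenCover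

namespace CechH0

variable {X : Type} [TopologicalSpace X]

/-- The class `c` is given by a cocycle whose values are those of the function `f`. -/
def Represents (f : X → ℤ) (c : CechH0 X) : Prop :=
  ∃ (𝒰 : OpenCover X) (σ : 𝒰.H0), of 𝒰 σ = c ∧ ∀ u : 𝒰.Vertex, ∀ x ∈ u.1, σ.1 u = f x

theorem refine_represents {𝒰 𝒱 : OpenCover X} (h : 𝒰 ≤ 𝒱) {σ : 𝒰.H0} {f : X → ℤ}
    (hσ : ∀ u : 𝒰.Vertex, ∀ x ∈ u.1, σ.1 u = f x) :
    ∀ v : 𝒱.Vertex, ∀ x ∈ v.1, (OpenCover.refine 𝒰 𝒱 h σ).1 v = f x :=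
  fun v x hx => hσ _ x (OpenCover.subset_refineVertex h v hx)

theorem of_refine {𝒰 𝒱 : OpenCover X} (h : 𝒰 ≤ 𝒱) (σ : 𝒰.H0) :
    of 𝒱 (OpenCover.refine 𝒰 𝒱 h σ) = of 𝒰 σ :=
  AddCommGroup.DirectLimit.of_f (G := fun 𝒰 : OpenCover X => 𝒰.H0) (f := OpenCover.refine) h σ

/-- Vertices of the nerve are nonempty sets, so on a common refinement both cocycles are read off
from the values of `f`. -/
theorem Represents.unique {f : X → ℤ} {c c' : CechH0 X} (h : Represents f c)
    (h' : Represents f c') : c = c' := by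
  obtain ⟨𝒰, σ, rfl, hσ⟩ := h
  obtain ⟨𝒱, τ, rfl, hτ⟩ := h'
  rw [← of_refine (OpenCover.le_inf_left 𝒰 𝒱), ← of_refine (OpenCover.le_inf_right 𝒰 𝒱)]
  congr 1
  refine Subtype.ext (funext fun w => ?_)
  obtain ⟨x, hx⟩ := w.2.2
  rw [refine_represents _ hσ w x hx, refine_represents _ hτ w x hx]

theorem Represents.add {f g : X → ℤ} {c c' : CechH0 X} (h : Represents f c)
    (h' : Represents g c') : Represents (f + g) (c + c') := by
  obtain ⟨𝒰, σ, rfl, hσ⟩ := h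
  obtain ⟨𝒱, τ, rfl, hτ⟩ := h'
  refine ⟨OpenCover.inf 𝒰 𝒱, OpenCover.refine _ _ (OpenCover.le_inf_left 𝒰 𝒱) σ +
    OpenCover.refine _ _ (OpenCover.le_inf_right 𝒰 𝒱) τ, ?_, fun w x hx => ?_⟩
  · rw [map_add, of_refine, of_refine]
  · rw [Pi.add_apply, ← refine_represents (OpenCover.le_inf_left 𝒰 𝒱) hσ w x hx,
      ← refine_represents (OpenCover.le_inf_right 𝒰 𝒱) hτ w x hx]
    rfl

theorem Represents.neg {f : X → ℤ} {c : CechH0 X} (h : Represents f c) :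
    Represents (-f) (-c) := by
  obtain ⟨𝒰, σ, rfl, hσ⟩ := h
  refine ⟨𝒰, -σ, map_neg _ _, fun u x hx => ?_⟩
  rw [Pi.neg_apply, ← hσ u x hx]
  rfl

theorem represents_zero : Represents (0 : X → ℤ) 0 :=
  ⟨Classical.arbitrary _, 0, map_zero _, fun _ _ _ => rfl⟩

/-- Every class is represented by a function that is locally constant. -/
theorem exists_represents (c : CechH0 X) : ∃ f : X → ℤ, Represents f c ∧
    ∀ x, ∃ u, IsOpen u ∧ x ∈ u ∧ ∀ y ∈ u, f y = f x := by
  induction c using AddCommGroup.DirectLimit.induction_on with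
  | ih 𝒰 σ =>
    have hv : ∀ x : X, ∃ u : 𝒰.Vertex, x ∈ u.1 := fun x => by
      obtain ⟨u, hu, hxu⟩ := mem_sUnion.1 (𝒰.covers ▸ mem_univ x)
      exact ⟨⟨u, hu, x, hxu⟩, hxu⟩
    choose u hu using hv
    have hf : ∀ v : 𝒰.Vertex, ∀ x ∈ v.1, σ.1 v = σ.1 (u x) := fun v x hx =>
      OpenCover.mem_H0.1 σ.2 _ _ ⟨x, hx, hu x⟩
    exact ⟨fun x => σ.1 (u x), ⟨𝒰, σ, rfl, hf⟩, fun x =>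
      ⟨(u x).1, 𝒰.isOpen _ (u x).2.1, hu x, fun y hy => (hf _ y hy).symm⟩⟩

end CechH0

/-! ### Pieces as supported classes, generation, and the computable bound. -/

namespace LinePattern

variable {n : ℕ}

/-! ### From functions on the boundary to classes -/

theorem exists_ray_subset {U : Set (Boundary n)} (hU : IsOpen U) {x : Boundary n} (hx : x ∈ U) :
    ∃ m, ∀ y, ray y m = ray x m → y ∈ U := by
  obtain ⟨V, hV, rfl⟩ := isOpen_induced_iff.1 hU
  obtain ⟨I, u, hu, hsub⟩ := isOpen_pi_iff.1 hV x.1 hx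
  refine ⟨I.sup id + 1, fun y e => hsub fun i hi => ?_⟩
  rw [ray_eq_ray_iff.1 e i (Nat.lt_succ_of_le (Finset.le_sup (f := id) hi))]
  exact (hu i hi).2

instance : CompactSpace (Boundary n) := by
  refine (isCompact_iff_compactSpace (X := ℕ → Fin n × Bool)
    (s := {ξ | ∀ k, (ξ k).1 = (ξ (k + 1)).1 → (ξ k).2 = (ξ (k + 1)).2})).1 (IsClosed.isCompact ?_)
  simp only [ofPred_forall]
  refine isClosed_iInter fun k => ?_
  have hc : Continuous fun ξ : ℕ → Fin n × Bool => (ξ k, ξ (k + 1)) :=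
    (continuous_apply k).prodMk (continuous_apply (k + 1))
  exact (isClosed_discrete {p : (Fin n × Bool) × (Fin n × Bool) |
    p.1.1 = p.2.1 → p.1.2 = p.2.2}).preimage hc

/-- A locally constant function depends on finitely many letters. -/
theorem exists_depth {f : Boundary n → ℤ}
    (hf : ∀ x, ∃ u, IsOpen u ∧ x ∈ u ∧ ∀ y ∈ u, f y = f x) :
    ∃ m, ∀ x y, ray x m = ray y m → f x = f y := by
  have h1 : ∀ x, ∃ m, ∀ y, ray y m = ray x m → f y = f x := fun x => by
    obtain ⟨u, hu, hx, h⟩ := hf x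
    obtain ⟨m, hm⟩ := exists_ray_subset hu hx
    exact ⟨m, fun y hy => h y (hm y hy)⟩
  choose m hm using h1
  obtain ⟨t, -, ht⟩ := isCompact_univ.elim_nhds_subcover (fun x => {y | ray y (m x) = ray x (m x)})
    fun x _ => (isOpen_of_ray_congr (m := m x) fun y z e hy => e.symm.trans hy).mem_nhds rfl
  refine ⟨t.sup m, fun x y e => ?_⟩
  obtain ⟨z, hz, hxz⟩ := mem_iUnion₂.1 (ht (mem_univ x))
  have e' := ray_eq_mono e (Finset.le_sup (f := m) hz)
  rw [hm z x hxz, hm z y (e'.symm.trans hxz)]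

/-- A piece defines a class that is supported on a ball. -/
theorem IsPiece.exists_supported {W : List (List (Fin n × Bool))} {v : FreeGroup (Fin n)} {R : ℕ}
    {f : Boundary n → ℤ} (hf : IsPiece W v R f) :
    ∃ F : DecompositionSpace (elements W) → ℤ, (∀ x, F (Quot.mk _ x) = f x) ∧
      ∃ c, CechH0.Represents F c ∧ IsSupportedOn (elements W) (ballAt v R) c := by
  obtain ⟨U, hU⟩ := exists_associatedFamily W v R
  let F : DecompositionSpace (elements W) → ℤ :=
    Quot.lift f fun x y h => hf.inv x y (partner_iff.2 (Or.inl h))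
  -- If a representative of `d` lies in another shadow `b`, then `U a` meets `U b`, so a line joins
  -- the two shadows. As `f` is constant on that line and on the shadow `b`, it carries the value at
  -- `d` into the shadow `a`.
  have hval : ∀ a, ∀ d ∈ U a, ∃ ξ ∈ shadowFrom (ballAt v R) a, F d = f ξ := by
    intro a d hd
    induction d using Quot.ind with
    | mk x =>
      obtain ⟨b, hb⟩ := exists_mem_shadowFrom v R x
      by_cases hab : a = b
      · exact ⟨x, hab ▸ hb, rfl⟩
      · have hadj := (hU.inter_nonempty_iff a b hab).1
          ⟨_, hd, hU.image_shadow_subset b ⟨x, hb, rfl⟩⟩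
        obtain ⟨-, ξ, hξ, η, hη, h⟩ := whiteheadGraph_adj_iff.1 hadj
        exact ⟨ξ, hξ, (hf.eq_of_mem_shadowFrom hb hη).trans (hf.inv ξ η h).symm⟩
  let 𝒰 : OpenCover (DecompositionSpace (elements W)) :=
    ⟨range U, by rintro _ ⟨a, rfl⟩; exact hU.isOpen a, by rw [sUnion_range]; exact hU.covers⟩
  have hconst : ∀ u : 𝒰.Vertex, ∀ d ∈ u.1, ∀ d' ∈ u.1, F d = F d' := by
    rintro ⟨_, ⟨a, rfl⟩, _⟩ d hd d' hd'
    obtain ⟨ξ, hξ, e⟩ := hval a d hd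
    obtain ⟨ξ', hξ', e'⟩ := hval a d' hd'
    rw [e, e', hf.eq_of_mem_shadowFrom hξ hξ']
  let σ : 𝒰.H0 := ⟨fun u => F u.2.2.some, OpenCover.mem_H0.2 fun u w ⟨d, hu, hw⟩ =>
    (hconst u _ u.2.2.some_mem d hu).trans (hconst w _ w.2.2.some_mem d hw).symm⟩
  exact ⟨F, fun _ => rfl, CechH0.of 𝒰 σ,
    ⟨𝒰, σ, rfl, fun u d hd => hconst u _ u.2.2.some_mem d hd⟩,
    𝒰, Or.inr ⟨⟨v, self_mem_ballAt v R⟩, U, hU, rfl⟩, σ, rfl⟩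

theorem closure_supported_eq_top (W : List (List (Fin n × Bool))) {N : ℕ}
    (hN : (2 * n + 1) ^ (stableDepth W + 1) ≤ N) :
    AddSubgroup.closure {c : CechH0 (DecompositionSpace (elements W)) |
      ∃ X : Finset (FreeGroup (Fin n)), IsSubtree X ∧ X.card ≤ N ∧
        IsSupportedOn (elements W) X c} = ⊤ := by
  refine (AddSubgroup.eq_top_iff' _).2 fun c => ?_
  obtain ⟨f, hfc, hf⟩ := CechH0.exists_represents c
  obtain ⟨m, hm⟩ := exists_depth (f := fun x => f (Quot.mk _ x)) fun x => by
    obtain ⟨u, hu, hx, h⟩ := hf (Quot.mk _ x)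
    exact ⟨_, hu.preimage continuous_quot_mk, hx, fun y hy => h _ hy⟩
  -- The half-tree behind the identity is the whole tree, so `f` is itself a piece at 1, of
  -- uncontrolled depth `m`.
  have hpiece : IsPiece W 1 m fun x => f (Quot.mk _ x) := by
    refine ⟨fun x y h => ?_, fun x hx => absurd rfl hx, ?_⟩
    · simp only [mk_eq_mk_iff.2 (Or.inr h)]
    · simpa using hm
  have key : ∀ g ∈ AddSubgroup.closure {f | ∃ v, IsPiece W v (stableDepth W + 1) f},
      ∃ F : DecompositionSpace (elements W) → ℤ, (∀ x, F (Quot.mk _ x) = g x) ∧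
        ∃ c ∈ AddSubgroup.closure {c : CechH0 (DecompositionSpace (elements W)) |
          ∃ X : Finset (FreeGroup (Fin n)), IsSubtree X ∧ X.card ≤ N ∧
            IsSupportedOn (elements W) X c}, CechH0.Represents F c := by
    intro g hg
    induction hg using AddSubgroup.closure_induction with
    | mem g hg =>
      obtain ⟨v, hv⟩ := hg
      obtain ⟨F, hF, c, hc, hs⟩ := hv.exists_supported
      exact ⟨F, hF, c, AddSubgroup.subset_closure
        ⟨_, isSubtree_ballAt _ _, (card_ballAt_le _ _).trans hN, hs⟩, hc⟩
    | zero => exact ⟨0, fun _ => rfl, 0, zero_mem _, CechH0.represents_zero⟩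
    | add g g' _ _ ih ih' =>
      obtain ⟨F, hF, c, hc, h⟩ := ih
      obtain ⟨F', hF', c', hc', h'⟩ := ih'
      exact ⟨F + F', fun x => by simp [hF, hF'], c + c', add_mem hc hc', h.add h'⟩
    | neg g _ ih =>
      obtain ⟨F, hF, c, hc, h⟩ := ih
      exact ⟨-F, fun x => by simp [hF], -c, neg_mem hc, h.neg⟩
  obtain ⟨F, hF, c', hc', h⟩ := key _ (hpiece.mem_closure m)
  have hFf : F = f := funext (Quot.ind hF)
  rw [hFf] at h
  rwa [hfc.unique h]

/-! ### Computability of the bound -/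

/-- The bound on the size of the subtrees, in terms of the rank and of the total length of the
words. -/
def sizeBound (n : ℕ) (L : List (List (ℕ × Bool))) : ℕ :=
  (2 * n + 1) ^ (n * 2 * ((2 * (L.flatten.length + L.length)) *
    (2 * (L.flatten.length + L.length))) + 1)

theorem length_positions (W : List (List (Fin n × Bool))) :
    (positions W).length = 2 * (W.flatten.length + W.length) := by
  have h : ∀ V : List (List (Fin n × Bool)),
      (V.flatMap fun u => (List.range (u.length + 1)).map fun j => (u, j)).length =
        V.flatten.length + V.length := by
    intro V
    induction V with
    | nil => rfl
    | cons u V ih =>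
      rw [List.flatMap_cons, List.length_append, ih, List.flatten_cons, List.length_append,
        List.length_map, List.length_range, List.length_cons]
      omega
  have h' : (W.map FreeGroup.invRev).flatten.length = W.flatten.length := by
    simp [List.length_flatten, Function.comp_def]
  rw [positions, h, symWords, List.flatten_append, List.length_append, List.length_append, h',
    List.length_map]
  omega

theorem sizeBound_encodeWords (W : List (List (Fin n × Bool))) :
    sizeBound n (encodeWords W) = (2 * n + 1) ^ (stableDepth W + 1) := by
  have h : (encodeWords W).flatten.length = W.flatten.length := by
    simp [encodeWords, List.length_flatten, Function.comp_def]
  have h' : (encodeWords W).length = W.length := by simp [encodeWords]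
  rw [sizeBound, stableDepth, length_positions, h, h']

theorem primrec₂_pow : Primrec₂ fun a b : ℕ => a ^ b := by
  have h : Primrec₂ fun a b : ℕ => Nat.rec (motive := fun _ => ℕ) 1 (fun _ p => p * a) b :=
    Primrec.nat_rec (Primrec.const 1)
      (Primrec.nat_mul.comp (Primrec.snd.comp Primrec.snd) Primrec.fst).to₂
  refine h.of_eq fun a b => ?_
  induction b with
  | zero => rfl
  | succ b ih => rw [pow_succ, ← ih]

theorem computable₂_sizeBound : Computable₂ sizeBound := by
  have hn : Primrec fun p : ℕ × List (List (ℕ × Bool)) => p.1 := Primrec.fst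
  have hp : Primrec fun p : ℕ × List (List (ℕ × Bool)) => 2 * (p.2.flatten.length + p.2.length) :=
    Primrec.nat_mul.comp (Primrec.const 2) (Primrec.nat_add.comp
      (Primrec.list_length.comp (Primrec.list_flatten.comp Primrec.snd))
      (Primrec.list_length.comp Primrec.snd))
  have h : Primrec fun p : ℕ × List (List (ℕ × Bool)) => sizeBound p.1 p.2 :=
    primrec₂_pow.comp (Primrec.succ.comp (Primrec.nat_mul.comp (Primrec.const 2) hn))
      (Primrec.succ.comp (Primrec.nat_mul.comp (Primrec.nat_mul.comp hn (Primrec.const 2))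
        (Primrec.nat_mul.comp hp hp)))
  exact h.to_comp

end LinePattern

theorem mainTheorem3 :
    ∃ N : ℕ → List (List (ℕ × Bool)) → ℕ, Computable₂ N ∧
      ∀ (n : ℕ) (W : List (List (Fin n × Bool))),
        AddSubgroup.closure
          {c : CechH0 (LinePattern.DecompositionSpace (LinePattern.elements W)) |
            ∃ X : Finset (FreeGroup (Fin n)), LinePattern.IsSubtree X ∧
              X.card ≤ N n (LinePattern.encodeWords W) ∧
              LinePattern.IsSupportedOn (LinePattern.elements W) X c} = ⊤ :=
  ⟨LinePattern.sizeBound, LinePattern.computable₂_sizeBound, fun _ W =>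
    LinePattern.closure_supported_eq_top W (LinePattern.sizeBound_encodeWords W).ge⟩
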